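/- Let $\alpha,b,c\in\mathbb R$ with $bc\ge 0$, let $L>0$ and $k\in\{0,1,-1\}$. Consider the Einstein–Maxwell–dilaton (EMD) system with action $$S=\int d^4x\sqrt{-g}\Bigl(R-\tfrac14 e^{-\alpha\phi}F^2-\tfrac12(\partial\phi)^2-V(\phi)\Bigr),\qquad F=dA,$$ $$V(\phi)=-\frac{2}{(1+\alpha^2)^2L^2}\Bigl[\alpha^2(3\alpha^2-1)e^{-\phi/\alpha}+8\alpha^2e^{(\alpha-1/\alpha)\phi/2}+(3-\alpha^2)e^{\alpha\phi}\Bigr]$$ (for $\alpha=0$, $V$ means the constant $-6/L^2$), that is, its field equations $$R_{\mu\nu}-\tfrac12Rg_{\mu\nu}=\tfrac12e^{-\alpha\phi}\bigl(F_{\mu\rho}F_\nu{}^\rho-\tfrac14F^2g_{\mu\nu}\bigr)+\tfrac12\bigl(\partial_\mu\phi\,\partial_\nu\phi-\tfrac12(\partial\phi)^2g_{\mu\nu}\bigr)-\tfrac12Vg_{\mu\nu},$$ $$\nabla_\mu(e^{-\alpha\phi}F^{\mu\nu})=0,\qquad \Box\phi=V'(\phi)-\tfrac{\alpha}{4}e^{-\alpha\phi}F^2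 .$$ For $a\ne0$ put $h_x=1+abx$, $h_y=1+aby$, $$F(y)=-(1-ky^2-acy^3)h_y^{\frac{1-\alpha^2}{1+\alpha^2}}+\frac{1}{a^2L^2}h_y^{\frac{2\alpha^2}{1+\alpha^2}},\qquad G(x)=(1-kx^2-acx^3)h_x^{\frac{1-\alpha^2}{1+\alpha^2}},$$ $$ds^2=\frac{1}{a^2(x-y)^2}\Bigl[h_x^{\frac{2\alpha^2}{1+\alpha^2}}\Bigl(-F(y)d\tau^2+\frac{dy^2}{F(y)}\Bigr)+h_y^{\frac{2\alpha^2}{1+\alpha^2}}\Bigl(\frac{dx^2}{G(x)}+G(x)d\varphi^2\Bigr)\Bigr],$$ $$A=2\sqrt{\tfrac{bc}{1+\alpha^2}}\;y\,d\tau,\qquad \phi=\frac{2\alpha}{1+\alpha^2}\log\frac{h_y}{h_x},$$ on the set $D_a$ of points $(\tau,y,x,\varphi)$ with $x\ne y$, $h_x,h_y>0$, $F(y)\neq0$, $G(x)>0$. 1. For every $a\neq 0$, $D_a$ is open and $(g,A,\phi)$ is a smooth solution of the EMD system on $D_a$ with $g$ of signature $(-,+,+,+)$, and $e^{\alpha\phi}=(h_y/h_x)^{2\alpha^2/(1+\alpha^2)}$.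 2. For every $a\ne 0$, under $y=-1/(ar)$, $\tau=at$ ($r\ne0$, at points mapped into $D_a$), the solution becomes $$ds^2=\frac{1}{(1+arx)^2}\Bigl[h_x^{\frac{2\alpha^2}{1+\alpha^2}}\Bigl(-F(r)dt^2+\frac{dr^2}{F(r)}\Bigr)+r^2h_r^{\frac{2\alpha^2}{1+\alpha^2}}\Bigl(\frac{dx^2}{G(x)}+G(x)d\varphi^2\Bigr)\Bigr],$$ with $h_r=1-b/r$, $F(r)=\bigl(k-\frac cr-a^2r^2\bigr)h_r^{\frac{1-\alpha^2}{1+\alpha^2}}+\frac{r^2}{L^2}h_r^{\frac{2\alpha^2}{1+\alpha^2}}$, $\phi=\frac{2\alpha}{1+\alpha^2}\log\frac{h_r}{h_x}$ and, for any constant $r_h\ne0$, after adding the constant form $\frac{2}{r_h}\sqrt{\frac{bc}{1+\alpha^2}}\,dt$ to the gauge field, $A=2\sqrt{\frac{bc}{1+\alpha^2}}\bigl(\frac1{r_h}-\frac1r\bigr)dt$. 3. As $a\to0$, at every fixed $(t,r,x,\varphi)$ with $r\ne0$, $1-b/r>0$, $f(r)\ne0$ and $1-kx^2>0$ (such a point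 is mapped into $D_a$ for all sufficiently small $a\ne0$), the components of the fields in part 2 converge to those of $$ds^2=-f\,dt^2+\frac{dr^2}{f}+U\,d\Sigma_{2,k}^2,\qquad A=2\sqrt{\tfrac{bc}{1+\alpha^2}}\Bigl(\frac1{r_h}-\frac1r\Bigr)dt,\qquad \phi=\frac{2\alpha}{1+\alpha^2}\log\Bigl(1-\frac br\Bigr),$$ $$f=\Bigl(k-\frac cr\Bigr)\Bigl(1-\frac br\Bigr)^{\frac{1-\alpha^2}{1+\alpha^2}}+\frac{r^2}{L^2}\Bigl(1-\frac br\Bigr)^{\frac{2\alpha^2}{1+\alpha^2}},\qquad U=r^2\Bigl(1-\frac br\Bigr)^{\frac{2\alpha^2}{1+\alpha^2}},$$ so that $e^{\alpha\phi}=(1-b/r)^{2\alpha^2/(1+\alpha^2)}$. For $A$, the constant $r_h$ may depend on $a$ as long as it converges to a nonzero limit, which is then the $r_h$ of the limit. Here $d\Sigma_{2,k}^2=\frac{dx^2}{1-kx^2}+(1-kx^2)d\varphi^2$, which has constant Gaussian curvature $k$ where $1-kx^2>0$. 4. Let $a\ne0$ and let $x_0$ be a real root of $$4a^2bc\,x^3+\bigl(3ac(\alpha^2+1)-abk(\alpha^2-3)\bigr)x^2+2k(\alpha^2+1)x+ab(3\alpha^2-1)=0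 .$$ At the points of $D_a$ with $x=x_0$ and $x_0-y>0$, the induced metric $h_{\mu\nu}=g_{\mu\nu}-n_\mu n_\nu$ and the extrinsic curvature $K_{\mu\nu}=h_\mu^\rho h_\nu^\sigma\nabla_\rho n_\sigma$ of the hypersurface $x=x_0$, with unit normal $n$ in the direction of increasing $ax$ (increasing $x$ if $a>0$), satisfy $K_{\mu\nu}=-\lambda(y)h_{\mu\nu}$, where $$\lambda(y)=\frac{a\sqrt{1-kx_0^2-acx_0^3}\,\bigl(1+abx_0+\alpha^2(1+aby)\bigr)}{(1+\alpha^2)(1+abx_0)^{\frac{1+3\alpha^2}{2(1+\alpha^2)}}(1+aby)^{\frac{\alpha^2}{1+\alpha^2}}} .$$ In particular the hypersurface is totally umbilic there. -/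

import Mathlib

open scoped ContDiff Topology
open Filter

noncomputable section

/-! Tensor calculus in a coordinate chart. A point of an `n`-dimensional chart is a tuple
`p : Fin n → ℝ`; tensor fields are given by their coordinate components. -/

namespace Chart

variable {n : ℕ}

/-- The partial derivative `∂ᵢ f` at `p`. -/
def pd (i : Fin n) (f : (Fin n → ℝ) → ℝ) (p : Fin n → ℝ) : ℝ :=
  deriv (fun s => f (Function.update p i s)) (p i)

/-- Christoffel symbol `Γⁱⱼₖ` of the Levi-Civita connection of the metric `g`. -/
def christoffel (g : (Fin n → ℝ) → Matrix (Fin n) (Fin n) ℝ) (i j k : Fin n)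
    (p : Fin n → ℝ) : ℝ :=
  (1 / 2) * ∑ l, (g p)⁻¹ i l *
    (pd j (fun q => g q l k) p + pd k (fun q => g q l j) p - pd l (fun q => g q j k) p)

/-- Ricci tensor
`Rⱼₖ = ∂ᵢ Γⁱⱼₖ - ∂ₖ Γⁱⱼᵢ + Γⁱᵢₗ Γˡⱼₖ - Γⁱₖₗ Γˡⱼᵢ` (positive on round spheres). -/
def ricci (g : (Fin n → ℝ) → Matrix (Fin n) (Fin n) ℝ) (j k : Fin n) (p : Fin n → ℝ) : ℝ :=
  ∑ i, (pd i (christoffel g i j k) p - pd k (christoffel g i j i) p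
    + ∑ l, (christoffel g i i l p * christoffel g l j k p
      - christoffel g i k l p * christoffel g l j i p))

/-- Scalar curvature `R = gⁱʲ Rᵢⱼ`. -/
def scalarCurvature (g : (Fin n → ℝ) → Matrix (Fin n) (Fin n) ℝ) (p : Fin n → ℝ) : ℝ :=
  ∑ i, ∑ j, (g p)⁻¹ i j * ricci g i j p

/-- The d'Alembertian `□φ = gⁱʲ (∂ᵢ ∂ⱼ φ - Γˡᵢⱼ ∂ₗ φ)`. -/
def box (g : (Fin n → ℝ) → Matrix (Fin n) (Fin n) ℝ) (φ : (Fin n → ℝ) → ℝ)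
    (p : Fin n → ℝ) : ℝ :=
  ∑ i, ∑ j, (g p)⁻¹ i j * (pd i (pd j φ) p - ∑ l, christoffel g l i j p * pd l φ p)

/-- `(∂φ)² = gⁱʲ ∂ᵢφ ∂ⱼφ`. -/
def gradSq (g : (Fin n → ℝ) → Matrix (Fin n) (Fin n) ℝ) (φ : (Fin n → ℝ) → ℝ)
    (p : Fin n → ℝ) : ℝ :=
  ∑ i, ∑ j, (g p)⁻¹ i j * (pd i φ p * pd j φ p)

/-- The field strength `F = dA`: `Fᵢⱼ = ∂ᵢ Aⱼ - ∂ⱼ Aᵢ`. -/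
def fieldStrength (A : (Fin n → ℝ) → Fin n → ℝ) (i j : Fin n) (p : Fin n → ℝ) : ℝ :=
  pd i (fun q => A q j) p - pd j (fun q => A q i) p

/-- `Fⁱʲ`, both indices raised with `g`. -/
def fieldStrengthUp (g : (Fin n → ℝ) → Matrix (Fin n) (Fin n) ℝ)
    (A : (Fin n → ℝ) → Fin n → ℝ) (i j : Fin n) (p : Fin n → ℝ) : ℝ :=
  ∑ k, ∑ l, (g p)⁻¹ i k * (g p)⁻¹ j l * fieldStrength A k l p

/-- `F² = Fᵢⱼ Fⁱʲ`. -/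
def fieldStrengthSq (g : (Fin n → ℝ) → Matrix (Fin n) (Fin n) ℝ)
    (A : (Fin n → ℝ) → Fin n → ℝ) (p : Fin n → ℝ) : ℝ :=
  ∑ i, ∑ j, fieldStrength A i j p * fieldStrengthUp g A i j p

/-- The divergence `∇ᵢ Hⁱʲ` of a contravariant 2-tensor field `H`. -/
def divergence₂ (g : (Fin n → ℝ) → Matrix (Fin n) (Fin n) ℝ)
    (H : Fin n → Fin n → (Fin n → ℝ) → ℝ) (j : Fin n) (p : Fin n → ℝ) : ℝ :=
  ∑ i, (pd i (H i j) p
    + ∑ l, (christoffel g i i l p * H l j p + christoffel g j i l p * H i l p))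

/-- Pull-back `(Ψ^* g)ᵢⱼ = ∂ᵢΨᵏ ∂ⱼΨˡ gₖₗ ∘ Ψ` of a covariant 2-tensor. -/
def pullbackMetric (Ψ : (Fin n → ℝ) → Fin n → ℝ)
    (g : (Fin n → ℝ) → Matrix (Fin n) (Fin n) ℝ) (p : Fin n → ℝ) :
    Matrix (Fin n) (Fin n) ℝ :=
  Matrix.of fun i j =>
    ∑ k, ∑ l, pd i (fun q => Ψ q k) p * pd j (fun q => Ψ q l) p * g (Ψ p) k l

/-- Pull-back `(Ψ^* A)ᵢ = ∂ᵢΨᵏ Aₖ ∘ Ψ` of a one-form. -/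
def pullbackForm (Ψ : (Fin n → ℝ) → Fin n → ℝ) (A : (Fin n → ℝ) → Fin n → ℝ)
    (p : Fin n → ℝ) : Fin n → ℝ :=
  fun i => ∑ k, pd i (fun q => Ψ q k) p * A (Ψ p) k

/-! Geometry of the level sets of a function `Φ` whose gradient is spacelike. -/

/-- The unit conormal `nᵢ = ∂ᵢΦ / √((∂Φ)²)` of the level sets of `Φ`, pointing towards
increasing `Φ`. -/
def unitConormal (g : (Fin n → ℝ) → Matrix (Fin n) (Fin n) ℝ) (Φ : (Fin n → ℝ) → ℝ)
    (i : Fin n) (p : Fin n → ℝ) : ℝ :=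
  pd i Φ p / Real.sqrt (gradSq g Φ p)

/-- The induced metric (first fundamental form) `hᵢⱼ = gᵢⱼ - nᵢ nⱼ` of the level sets. -/
def inducedMetric (g : (Fin n → ℝ) → Matrix (Fin n) (Fin n) ℝ) (Φ : (Fin n → ℝ) → ℝ)
    (i j : Fin n) (p : Fin n → ℝ) : ℝ :=
  g p i j - unitConormal g Φ i p * unitConormal g Φ j p

/-- The tangential projector `hⁱⱼ = δⁱⱼ - nⁱ nⱼ`. -/
def tangentialProj (g : (Fin n → ℝ) → Matrix (Fin n) (Fin n) ℝ) (Φ : (Fin n → ℝ) → ℝ)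
    (i j : Fin n) (p : Fin n → ℝ) : ℝ :=
  (if i = j then 1 else 0) - (∑ l, (g p)⁻¹ i l * unitConormal g Φ l p) * unitConormal g Φ j p

/-- The extrinsic curvature (second fundamental form) `Kᵢⱼ = hᵏᵢ hˡⱼ ∇ₖ nₗ` of the level sets. -/
def extrinsicCurvature (g : (Fin n → ℝ) → Matrix (Fin n) (Fin n) ℝ) (Φ : (Fin n → ℝ) → ℝ)
    (i j : Fin n) (p : Fin n → ℝ) : ℝ :=
  ∑ k, ∑ l, tangentialProj g Φ k i p * tangentialProj g Φ l j p *
    (pd k (unitConormal g Φ l) p - ∑ m, christoffel g m k l p * unitConormal g Φ m p)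

end Chart

/-! The Einstein-Maxwell-dilaton system and its solutions. -/

namespace EMD

open Chart

/-- A chart of a four-dimensional spacetime. -/
abbrev Spacetime : Type := Fin 4 → ℝ

/-- A symmetric bilinear form on `ℝ⁴` of signature `(-,+,+,+)`. -/
def IsLorentzian (M : Matrix (Fin 4) (Fin 4) ℝ) : Prop :=
  ∃ E : Matrix (Fin 4) (Fin 4) ℝ, IsUnit E.det ∧
    E.transpose * M * E = Matrix.diagonal ![-1, 1, 1, 1]

/-- The dilaton potential `V(φ)`. At `α = 0` the first two terms carry the factor `α² = 0`, so
that the value is `-6/L²`, the limit of `V(φ)` as `α → 0` with `φ/α` bounded. -/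
def potential (α L : ℝ) (φ : ℝ) : ℝ :=
  -(2 / ((1 + α ^ 2) ^ 2 * L ^ 2)) *
    (α ^ 2 * (3 * α ^ 2 - 1) * Real.exp (-φ / α)
      + 8 * α ^ 2 * Real.exp ((α - 1 / α) * φ / 2)
      + (3 - α ^ 2) * Real.exp (α * φ))

/-- `(g, A, φ)` is a smooth solution on the open set `U` of the field equations of the action
`S = ∫ √(-g) (R - ¼ e^{-αφ} F² - ½ (∂φ)² - V(φ))`, i.e. of the Euler-Lagrange equations with
respect to `g`, `A` and `φ`. -/
structure IsSolutionOn (α : ℝ) (V : ℝ → ℝ) (U : Set Spacetime)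
    (g : Spacetime → Matrix (Fin 4) (Fin 4) ℝ) (A : Spacetime → Fin 4 → ℝ)
    (φ : Spacetime → ℝ) : Prop where
  isOpen : IsOpen U
  smooth_metric : ∀ i j, ContDiffOn ℝ ∞ (fun p => g p i j) U
  smooth_gauge : ∀ i, ContDiffOn ℝ ∞ (fun p => A p i) U
  smooth_dilaton : ContDiffOn ℝ ∞ φ U
  lorentzian : ∀ p ∈ U, IsLorentzian (g p)
  /-- `Rᵢⱼ - ½ R gᵢⱼ = ½ e^{-αφ} (Fᵢₖ Fⱼᵏ - ¼ F² gᵢⱼ) + ½ (∂ᵢφ ∂ⱼφ - ½ (∂φ)² gᵢⱼ) - ½ V gᵢⱼ`. -/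
  einstein : ∀ p ∈ U, ∀ i j,
    ricci g i j p - (1 / 2) * scalarCurvature g p * g p i j =
      (1 / 2) * Real.exp (-α * φ p) *
          ((∑ k, ∑ l, (g p)⁻¹ k l * (fieldStrength A i k p * fieldStrength A j l p))
            - (1 / 4) * fieldStrengthSq g A p * g p i j)
        + (1 / 2) * (pd i φ p * pd j φ p - (1 / 2) * gradSq g φ p * g p i j)
        - (1 / 2) * V (φ p) * g p i j
  /-- `∇ᵢ (e^{-αφ} Fⁱʲ) = 0`. -/
  maxwell : ∀ p ∈ U, ∀ j,
    divergence₂ g (fun i l q => Real.exp (-α * φ q) * fieldStrengthUp g A i l q) j p = 0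
  /-- `□φ = V'(φ) - (α/4) e^{-αφ} F²`. -/
  dilaton : ∀ p ∈ U,
    box g φ p = deriv V (φ p) - (α / 4) * Real.exp (-α * φ p) * fieldStrengthSq g A p

/-! The C-metric in the coordinates `(τ, y, x, φ)` (indices `0, 1, 2, 3`). -/

/-- `h_ξ = 1 + a b ξ`, used for `ξ = x` and `ξ = y`. -/
def h (a b ξ : ℝ) : ℝ := 1 + a * b * ξ

/-- The cubic `1 - k ξ² - a c ξ³`. -/
def cubicP (a c k ξ : ℝ) : ℝ := 1 - k * ξ ^ 2 - a * c * ξ ^ 3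

def cF (α a b c k L y : ℝ) : ℝ :=
  -(cubicP a c k y) * h a b y ^ ((1 - α ^ 2) / (1 + α ^ 2))
    + 1 / (a ^ 2 * L ^ 2) * h a b y ^ (2 * α ^ 2 / (1 + α ^ 2))

def cG (α a b c k x : ℝ) : ℝ :=
  cubicP a c k x * h a b x ^ ((1 - α ^ 2) / (1 + α ^ 2))

def cMetric (α a b c k L : ℝ) (p : Spacetime) : Matrix (Fin 4) (Fin 4) ℝ :=
  (1 / (a ^ 2 * (p 2 - p 1) ^ 2)) • Matrix.diagonal
    ![h a b (p 2) ^ (2 * α ^ 2 / (1 + α ^ 2)) * (-cF α a b c k L (p 1)),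
      h a b (p 2) ^ (2 * α ^ 2 / (1 + α ^ 2)) * (1 / cF α a b c k L (p 1)),
      h a b (p 1) ^ (2 * α ^ 2 / (1 + α ^ 2)) * (1 / cG α a b c k (p 2)),
      h a b (p 1) ^ (2 * α ^ 2 / (1 + α ^ 2)) * cG α a b c k (p 2)]

/-- `A = 2 √(bc/(1+α²)) y dτ`. -/
def cGauge (α b c : ℝ) (p : Spacetime) : Fin 4 → ℝ :=
  ![2 * Real.sqrt (b * c / (1 + α ^ 2)) * p 1, 0, 0, 0]

/-- `φ = (2α/(1+α²)) log (h_y/h_x)`. -/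
def cDilaton (α a b : ℝ) (p : Spacetime) : ℝ :=
  2 * α / (1 + α ^ 2) * Real.log (h a b (p 1) / h a b (p 2))

/-- The points at which the C-metric is a regular metric of signature `(-,+,+,+)`: `x ≠ y`,
`h_x, h_y > 0`, `F(y) ≠ 0` and `G(x) > 0`. -/
def cDomain (α a b c k L : ℝ) : Set Spacetime :=
  {p | p 2 ≠ p 1 ∧ 0 < h a b (p 2) ∧ 0 < h a b (p 1) ∧ cF α a b c k L (p 1) ≠ 0 ∧
    0 < cG α a b c k (p 2)}

/-! The C-metric in the coordinates `(t, r, x, φ)`. -/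

/-- The coordinate transformation `(t, r, x, φ) ↦ (τ, y, x, φ)`, `τ = a t`, `y = -1/(a r)`. -/
def coordChange (a : ℝ) (p : Spacetime) : Spacetime :=
  ![a * p 0, -1 / (a * p 1), p 2, p 3]

def cF' (α a b c k L r : ℝ) : ℝ :=
  (k - c / r - a ^ 2 * r ^ 2) * (1 - b / r) ^ ((1 - α ^ 2) / (1 + α ^ 2))
    + r ^ 2 / L ^ 2 * (1 - b / r) ^ (2 * α ^ 2 / (1 + α ^ 2))

def cMetric' (α a b c k L : ℝ) (p : Spacetime) : Matrix (Fin 4) (Fin 4) ℝ :=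
  (1 / (1 + a * p 1 * p 2) ^ 2) • Matrix.diagonal
    ![h a b (p 2) ^ (2 * α ^ 2 / (1 + α ^ 2)) * (-cF' α a b c k L (p 1)),
      h a b (p 2) ^ (2 * α ^ 2 / (1 + α ^ 2)) * (1 / cF' α a b c k L (p 1)),
      (p 1) ^ 2 * (1 - b / p 1) ^ (2 * α ^ 2 / (1 + α ^ 2)) * (1 / cG α a b c k (p 2)),
      (p 1) ^ 2 * (1 - b / p 1) ^ (2 * α ^ 2 / (1 + α ^ 2)) * cG α a b c k (p 2)]

def cDilaton' (α a b : ℝ) (p : Spacetime) : ℝ :=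
  2 * α / (1 + α ^ 2) * Real.log ((1 - b / p 1) / h a b (p 2))

/-! The static solution in the coordinates `(t, r, x, φ)`. -/

/-- The metric `dΣ²_{2,k} = dx²/(1 - k x²) + (1 - k x²) dφ²` in the coordinates `(x, φ)`. -/
def sigmaMetric (k : ℝ) (q : Fin 2 → ℝ) : Matrix (Fin 2) (Fin 2) ℝ :=
  Matrix.diagonal ![1 / (1 - k * q 0 ^ 2), 1 - k * q 0 ^ 2]

def staticF (α b c k L r : ℝ) : ℝ :=
  (k - c / r) * (1 - b / r) ^ ((1 - α ^ 2) / (1 + α ^ 2))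
    + r ^ 2 / L ^ 2 * (1 - b / r) ^ (2 * α ^ 2 / (1 + α ^ 2))

def staticU (α b r : ℝ) : ℝ := r ^ 2 * (1 - b / r) ^ (2 * α ^ 2 / (1 + α ^ 2))

/-- `ds² = -f(r) dt² + dr²/f(r) + U(r) dΣ²_{2,k}`. -/
def staticMetric (α b c k L : ℝ) (p : Spacetime) : Matrix (Fin 4) (Fin 4) ℝ :=
  Matrix.diagonal
    ![-staticF α b c k L (p 1), 1 / staticF α b c k L (p 1),
      staticU α b (p 1) * sigmaMetric k ![p 2, p 3] 0 0,
      staticU α b (p 1) * sigmaMetric k ![p 2, p 3] 1 1]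

/-- `A = 2 √(bc/(1+α²)) (1/r_h - 1/r) dt`; the same formula in the C-metric and in the static
solution, where `r_h` only fixes the additive constant. -/
def gauge' (α b c rh : ℝ) (p : Spacetime) : Fin 4 → ℝ :=
  ![2 * Real.sqrt (b * c / (1 + α ^ 2)) * (1 / rh - 1 / p 1), 0, 0, 0]

/-- `φ = (2α/(1+α²)) log (1 - b/r)`, so that `e^{αφ} = (1 - b/r)^{2α²/(1+α²)}`. -/
def staticDilaton (α b : ℝ) (p : Spacetime) : ℝ :=
  2 * α / (1 + α ^ 2) * Real.log (1 - b / p 1)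

/-- The points at which the static metric is regular of signature `(-,+,+,+)`. -/
def staticDomain (α b c k L : ℝ) : Set Spacetime :=
  {p | p 1 ≠ 0 ∧ 0 < 1 - b / p 1 ∧ staticF α b c k L (p 1) ≠ 0 ∧ 0 < 1 - k * p 2 ^ 2}

/-! The totally umbilic hypersurface. -/

/-- The cubic polynomial whose roots are the positions `x₀` of the umbilic hypersurfaces. -/
def braneCubic (α a b c k x : ℝ) : ℝ :=
  4 * a ^ 2 * b * c * x ^ 3
    + (3 * a * c * (α ^ 2 + 1) - a * b * k * (α ^ 2 - 3)) * x ^ 2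
    + 2 * k * (α ^ 2 + 1) * x + a * b * (3 * α ^ 2 - 1)

def braneLambda (α a b c k x₀ y : ℝ) : ℝ :=
  a * Real.sqrt (1 - k * x₀ ^ 2 - a * c * x₀ ^ 3)
      * (1 + a * b * x₀ + α ^ 2 * (1 + a * b * y)) /
    ((1 + α ^ 2) * (1 + a * b * x₀) ^ ((1 + 3 * α ^ 2) / (2 * (1 + α ^ 2)))
      * (1 + a * b * y) ^ (α ^ 2 / (1 + α ^ 2)))

end EMD

end

/-! The metric is diagonal and depends on two coordinates only, so its curvature is governed by the
logarithmic derivatives `P j i` = ∂ⱼ log |dᵢ| of the diagonal entries and by their derivatives `Q`.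
`DiagonalJet` packages this data, and `ricci_zero_zero` and its companions turn the Ricci tensor
into short expressions in `P`, `Q` and 1/dᵢ.

All non-integer powers reduce to β = 2α²/(1+α²). Since (1-α²)/(1+α²) = 1 - β, the functions F and G
involve only A = h_x^β, B = h_y^β and h_x/A, h_y/B, and each derivative only brings down a factor
ab/h. Once A and B are treated as independent nonzero variables, the field equations become
identities of rational functions: the `identity_*` lemmas under `Coefficients`. The constants match
because e² = 2bc(2-β) for the Maxwell coefficient, (2α/(1+α²))² = β(2-β) for the dilaton
coefficient, and e^{αφ} = B/A, which makes V(φ) equal to B/A times a quadratic polynomial in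
h_x/h_y.

The Maxwell stress is traceless in dimension four, so the Einstein equation is equivalent to R_ij =
(±S + V/2) g_ij + ½ ∂ᵢφ ∂ⱼφ, with sign + on (τ, y) and - on (x, φ). This is `ricci_cMetric`. The
Maxwell equation says that e^{-αφ} √|g| F^{yτ} does not depend on y.

In the coordinates (t, r, x, φ) the fields are continuous in a at a = 0, where their value is the
static solution; the limit is obtained by evaluation there.

For a level set of the coordinate m in a diagonal metric, K_ii is proportional to `P m i` dᵢ, so the
level set is umbilic where `P m i` is the same for all i ≠ m. For x = x₀ this requires G'/G = β
ab/h_x, that is, a critical point of G/h_x^β; clearing denominators gives the cubic. -/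

noncomputable section

/-! Diagonal metrics: Christoffel symbols and curvature from logarithmic derivatives. -/

namespace Chart

variable {n : ℕ}

/-- `f` has partial derivative `f'` in the direction of the `i`-th coordinate at `p`. -/
def HasPartialAt (i : Fin n) (f : (Fin n → ℝ) → ℝ) (f' : ℝ) (p : Fin n → ℝ) : Prop :=
  HasDerivAt (fun s => f (Function.update p i s)) f' (p i)

theorem HasPartialAt.pd_eq {i : Fin n} {f : (Fin n → ℝ) → ℝ} {f' : ℝ} {p : Fin n → ℝ}
    (hf : HasPartialAt i f f' p) : pd i f p = f' :=
  hf.deriv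

/-- Lets a formula valid near p be differentiated along a coordinate line. Every second derivative
below is computed this way, because the first derivatives are known only on an open set. -/
theorem eventually_update {p : Fin n → ℝ} (i : Fin n) {r : (Fin n → ℝ) → Prop}
    (hr : ∀ᶠ q in 𝓝 p, r q) : ∀ᶠ s in 𝓝 (p i), r (Function.update p i s) := by
  have hc : ContinuousAt (fun s : ℝ => Function.update p i s) (p i) :=
    (continuous_const.update i continuous_id).continuousAt
  have : Tendsto (fun s : ℝ => Function.update p i s) (𝓝 (p i)) (𝓝 p) := by
    simpa [ContinuousAt] using hc
  exact this.eventually hr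

theorem HasPartialAt.congr {i : Fin n} {f f₁ : (Fin n → ℝ) → ℝ} {f' : ℝ} {p : Fin n → ℝ}
    (hf : HasPartialAt i f f' p) (h : ∀ᶠ q in 𝓝 p, f₁ q = f q) : HasPartialAt i f₁ f' p :=
  HasDerivAt.congr_of_eventuallyEq hf (eventually_update i h)

theorem HasPartialAt.const (i : Fin n) (c : ℝ) (p : Fin n → ℝ) :
    HasPartialAt i (fun _ => c) 0 p :=
  hasDerivAt_const _ _

theorem HasPartialAt.add {i : Fin n} {f g : (Fin n → ℝ) → ℝ} {f' g' : ℝ} {p : Fin n → ℝ}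
    (hf : HasPartialAt i f f' p) (hg : HasPartialAt i g g' p) :
    HasPartialAt i (fun q => f q + g q) (f' + g') p :=
  HasDerivAt.add hf hg

theorem HasPartialAt.sub {i : Fin n} {f g : (Fin n → ℝ) → ℝ} {f' g' : ℝ} {p : Fin n → ℝ}
    (hf : HasPartialAt i f f' p) (hg : HasPartialAt i g g' p) :
    HasPartialAt i (fun q => f q - g q) (f' - g') p :=
  HasDerivAt.sub hf hg

theorem HasPartialAt.const_mul {i : Fin n} {f : (Fin n → ℝ) → ℝ} {f' : ℝ} {p : Fin n → ℝ}
    (c : ℝ) (hf : HasPartialAt i f f' p) : HasPartialAt i (fun q => c * f q) (c * f') p :=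
  HasDerivAt.const_mul c hf

theorem HasPartialAt.mul {i : Fin n} {f g : (Fin n → ℝ) → ℝ} {f' g' : ℝ} {p : Fin n → ℝ}
    (hf : HasPartialAt i f f' p) (hg : HasPartialAt i g g' p) :
    HasPartialAt i (fun q => f q * g q) (f' * g p + f p * g') p := by
  unfold HasPartialAt at *
  simpa using HasDerivAt.fun_mul hf hg

theorem HasPartialAt.div {i : Fin n} {f g : (Fin n → ℝ) → ℝ} {f' g' : ℝ} {p : Fin n → ℝ}
    (hf : HasPartialAt i f f' p) (hg : HasPartialAt i g g' p) (h0 : g p ≠ 0) :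
    HasPartialAt i (fun q => f q / g q) ((f' * g p - f p * g') / g p ^ 2) p := by
  unfold HasPartialAt at *
  simpa using HasDerivAt.fun_div hf hg (by simpa using h0)

theorem HasPartialAt.log {i : Fin n} {f : (Fin n → ℝ) → ℝ} {f' : ℝ} {p : Fin n → ℝ}
    (hf : HasPartialAt i f f' p) (h0 : f p ≠ 0) :
    HasPartialAt i (fun q => Real.log (f q)) (f' / f p) p := by
  unfold HasPartialAt at *
  simpa using HasDerivAt.log hf (by simpa using h0)

/-- A function of the `i`-th coordinate alone. -/
theorem HasPartialAt.of_hasDerivAt {i : Fin n} {f : ℝ → ℝ} {f' : ℝ} {p : Fin n → ℝ}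
    (hf : HasDerivAt f f' (p i)) (j : Fin n) :
    HasPartialAt j (fun q => f (q i)) (if j = i then f' else 0) p := by
  unfold HasPartialAt
  by_cases hj : j = i
  · subst hj; simpa using hf
  · have hj' : i ≠ j := Ne.symm hj
    simpa [hj, Function.update_of_ne hj'] using hasDerivAt_const (p j) (f (p i))

/-- The metric `g` is diagonal with entries `d i`, which do not vanish near `p` and have
logarithmic partial derivatives `P j i = ∂ⱼ log |d i|`; at `p`, `∂ₖ P j i = Q k j i`. -/
structure DiagonalJet (g : (Fin n → ℝ) → Matrix (Fin n) (Fin n) ℝ)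
    (d : Fin n → (Fin n → ℝ) → ℝ) (P : Fin n → Fin n → (Fin n → ℝ) → ℝ)
    (Q : Fin n → Fin n → Fin n → ℝ) (p : Fin n → ℝ) : Prop where
  diag : ∀ q, g q = Matrix.diagonal (fun i => d i q)
  ne_zero : ∀ᶠ q in 𝓝 p, ∀ i, d i q ≠ 0
  first : ∀ᶠ q in 𝓝 p, ∀ j i, HasPartialAt j (d i) (P j i q * d i q) q
  second : ∀ k j i, HasPartialAt k (P j i) (Q k j i) p

/-- The Christoffel symbols of a diagonal metric. -/
def diagChristoffel (d : Fin n → (Fin n → ℝ) → ℝ) (P : Fin n → Fin n → (Fin n → ℝ) → ℝ)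
    (i j k : Fin n) (q : Fin n → ℝ) : ℝ :=
  (1 / 2) * ((if i = k then P j i q else 0) + (if i = j then P k i q else 0)
    - if j = k then P i j q * (d j q / d i q) else 0)

/-- The partial derivatives `∂ₘ Γⁱⱼₖ` of the Christoffel symbols of a diagonal metric. -/
def diagChristoffelDeriv (d : Fin n → (Fin n → ℝ) → ℝ) (P : Fin n → Fin n → (Fin n → ℝ) → ℝ)
    (Q : Fin n → Fin n → Fin n → ℝ) (m i j k : Fin n) (q : Fin n → ℝ) : ℝ :=
  (1 / 2) * ((if i = k then Q m j i else 0) + (if i = j then Q m k i else 0)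
    - if j = k then (Q m i j + P i j q * (P m j q - P m i q)) * (d j q / d i q) else 0)

namespace DiagonalJet

variable {g : (Fin n → ℝ) → Matrix (Fin n) (Fin n) ℝ} {d : Fin n → (Fin n → ℝ) → ℝ}
  {P : Fin n → Fin n → (Fin n → ℝ) → ℝ} {Q : Fin n → Fin n → Fin n → ℝ} {p : Fin n → ℝ}

theorem inv_apply (hj : DiagonalJet g d P Q p) {q : Fin n → ℝ} (hq : ∀ i, d i q ≠ 0)
    (i j : Fin n) : (g q)⁻¹ i j = if i = j then (d i q)⁻¹ else 0 := by
  have : (g q)⁻¹ = Matrix.diagonal (fun i => (d i q)⁻¹) := by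
    apply Matrix.inv_eq_right_inv
    rw [hj.diag, Matrix.diagonal_mul_diagonal, ← Matrix.diagonal_one]
    congr 1
    funext i
    exact mul_inv_cancel₀ (hq i)
  rw [this, Matrix.diagonal_apply]

theorem ne_zero_self (hj : DiagonalJet g d P Q p) (i : Fin n) : d i p ≠ 0 :=
  hj.ne_zero.self_of_nhds i

/-- The formula is needed on a neighbourhood, not just at p, since the Ricci tensor differentiates
the Christoffel symbols. Only the term l = i survives in the sum, and ∂ⱼdᵢ = `P j i` dᵢ cancels the
1/dᵢ. -/
theorem christoffel_eventually (hj : DiagonalJet g d P Q p) (i j k : Fin n) :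
    ∀ᶠ q in 𝓝 p, christoffel g i j k q = diagChristoffel d P i j k q := by
  filter_upwards [hj.ne_zero, hj.first] with q hne hfirst
  have hpd : ∀ m l r, pd m (fun q => g q l r) q = if l = r then P m l q * d l q else 0 := by
    intro m l r
    by_cases hlr : l = r
    · subst hlr
      simp only [hj.diag, Matrix.diagonal_apply_eq, if_true]
      exact (hfirst m l).pd_eq
    · simp only [hj.diag, Matrix.diagonal_apply_ne _ hlr, if_neg hlr]
      exact (HasPartialAt.const m 0 q).pd_eq
  simp only [christoffel, hpd, hj.inv_apply hne, ite_mul, zero_mul, Finset.sum_ite_eq,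
    Finset.mem_univ, if_true, diagChristoffel]
  have hi := hne i
  by_cases h1 : i = k <;> by_cases h2 : i = j <;> by_cases h3 : j = k <;> subst_vars <;>
    simp_all <;> field_simp <;>
    exact mul_div_cancel_left₀ _ (hne _)

theorem christoffel_eq (hj : DiagonalJet g d P Q p) (i j k : Fin n) :
    christoffel g i j k p = diagChristoffel d P i j k p :=
  (hj.christoffel_eventually i j k).self_of_nhds

theorem pd_christoffel (hj : DiagonalJet g d P Q p) (m i j k : Fin n) :
    pd m (christoffel g i j k) p = diagChristoffelDeriv d P Q m i j k p := by
  refine HasPartialAt.pd_eq (HasPartialAt.congr ?_ (hj.christoffel_eventually i j k))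
  have hf := hj.first.self_of_nhds
  have hne := hj.ne_zero_self
  refine HasPartialAt.const_mul _ (((?_ : HasPartialAt m _ _ p).add ?_).sub ?_)
  · by_cases h : i = k
    · simpa only [h, if_true] using hj.second m j k
    · simpa only [h, if_false] using HasPartialAt.const m 0 p
  · by_cases h : i = j
    · simpa only [h, if_true] using hj.second m k j
    · simpa only [h, if_false] using HasPartialAt.const m 0 p
  · by_cases h : j = k
    -- The quotient d_k/dᵢ has logarithmic derivative `P m k - P m i`, which produces the quadratic
    -- term of `diagChristoffelDeriv`.
    · simp only [h, if_true]
      convert (hj.second m i k).mul ((hf m k).div (hf m i) (hne i)) using 1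
      have := hne i
      field_simp
    · simpa only [h, if_false] using HasPartialAt.const m 0 p

theorem ricci_eq (hj : DiagonalJet g d P Q p) (j k : Fin n) :
    ricci g j k p = ∑ i, (diagChristoffelDeriv d P Q i i j k p
      - diagChristoffelDeriv d P Q k i j i p
      + ∑ l, (diagChristoffel d P i i l p * diagChristoffel d P l j k p
        - diagChristoffel d P i k l p * diagChristoffel d P l j i p)) := by
  simp only [ricci, hj.pd_christoffel, hj.christoffel_eq]

theorem scalarCurvature_eq (hj : DiagonalJet g d P Q p) :
    scalarCurvature g p = ∑ i, (d i p)⁻¹ * ricci g i i p := by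
  simp [scalarCurvature, hj.inv_apply hj.ne_zero_self]

theorem gradSq_eq (hj : DiagonalJet g d P Q p) (φ : (Fin n → ℝ) → ℝ) :
    gradSq g φ p = ∑ i, (d i p)⁻¹ * (pd i φ p * pd i φ p) := by
  simp [gradSq, hj.inv_apply hj.ne_zero_self]

theorem box_eq (hj : DiagonalJet g d P Q p) (φ : (Fin n → ℝ) → ℝ) :
    box g φ p = ∑ i, (d i p)⁻¹ *
      (pd i (pd i φ) p - ∑ l, diagChristoffel d P l i i p * pd l φ p) := by
  simp [box, hj.inv_apply hj.ne_zero_self, hj.christoffel_eq]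

theorem fieldStrengthUp_eq (hj : DiagonalJet g d P Q p) (A : (Fin n → ℝ) → Fin n → ℝ)
    (i j : Fin n) {q : Fin n → ℝ} (hq : ∀ i, d i q ≠ 0) :
    fieldStrengthUp g A i j q = (d i q)⁻¹ * (d j q)⁻¹ * fieldStrength A i j q := by
  simp [fieldStrengthUp, hj.inv_apply hq]

end DiagonalJet

end Chart

/-! The C-metric: derivatives of its coefficient functions. -/

namespace EMD

open Chart

theorem hasDerivAt_h (a b ξ : ℝ) : HasDerivAt (h a b) (a * b) ξ := by
  have := ((hasDerivAt_id' ξ).const_mul (a * b)).const_add 1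
  rwa [mul_one] at this

/-- Written as a logarithmic derivative times the same power, so that h^e stays the only irrational
quantity under repeated differentiation. -/
theorem hasDerivAt_h_rpow {a b ξ : ℝ} (e : ℝ) (hξ : 0 < h a b ξ) :
    HasDerivAt (fun z => h a b z ^ e) (e * (a * b / h a b ξ) * h a b ξ ^ e) ξ := by
  refine HasDerivAt.congr_deriv ((hasDerivAt_h a b ξ).rpow_const (p := e) (Or.inl hξ.ne')) ?_
  rw [Real.rpow_sub_one hξ.ne']
  ring

theorem hasDerivAt_h_log {a b ξ : ℝ} (hξ : 0 < h a b ξ) :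
    HasDerivAt (fun z => a * b / h a b z) (-(a * b / h a b ξ) ^ 2) ξ := by
  refine HasDerivAt.congr_deriv ((hasDerivAt_const ξ (a * b)).fun_div (hasDerivAt_h a b ξ) hξ.ne') ?_
  have := hξ.ne'
  field_simp
  ring

/-- The exponent `2α²/(1+α²)`. -/
def expo (α : ℝ) : ℝ := 2 * α ^ 2 / (1 + α ^ 2)

theorem one_add_sq_pos (α : ℝ) : 0 < 1 + α ^ 2 := by positivity

theorem one_sub_expo (α : ℝ) : (1 - α ^ 2) / (1 + α ^ 2) = 1 - expo α := by
  have := (one_add_sq_pos α).ne'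
  unfold expo
  field_simp
  ring

theorem h_rpow_one_sub_expo (α : ℝ) {a b ξ : ℝ} (hξ : 0 < h a b ξ) :
    h a b ξ ^ (1 - expo α) = h a b ξ / h a b ξ ^ expo α := by
  rw [Real.rpow_sub hξ, Real.rpow_one]

/-- The derivative of `cG`. -/
def cG1 (α a b c k x : ℝ) : ℝ :=
  ((-2 * k * x - 3 * a * c * x ^ 2) + cubicP a c k x * ((1 - expo α) * (a * b / h a b x)))
    * h a b x ^ (1 - expo α)

/-- The second derivative of `cG`. -/
def cG2 (α a b c k x : ℝ) : ℝ :=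
  ((-2 * k - 6 * a * c * x)
      + 2 * (-2 * k * x - 3 * a * c * x ^ 2) * ((1 - expo α) * (a * b / h a b x))
      - cubicP a c k x * ((1 - expo α) * expo α * (a * b / h a b x) ^ 2))
    * h a b x ^ (1 - expo α)

/-- The derivative of `cF`. -/
def cF1 (α a b c k L y : ℝ) : ℝ :=
  -cG1 α a b c k y
    + 1 / (a ^ 2 * L ^ 2) * (expo α * (a * b / h a b y) * h a b y ^ expo α)

/-- The second derivative of `cF`. -/
def cF2 (α a b c k L y : ℝ) : ℝ :=
  -cG2 α a b c k y
    + 1 / (a ^ 2 * L ^ 2)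
      * (expo α * (expo α - 1) * (a * b / h a b y) ^ 2 * h a b y ^ expo α)

theorem cG_eq (α a b c k x : ℝ) :
    cG α a b c k x = cubicP a c k x * h a b x ^ (1 - expo α) := by
  rw [cG, one_sub_expo]

theorem cF_eq (α a b c k L y : ℝ) :
    cF α a b c k L y = -cG α a b c k y + 1 / (a ^ 2 * L ^ 2) * h a b y ^ expo α := by
  rw [cF, cG, expo]
  ring

theorem hasDerivAt_cubicP (a c k ξ : ℝ) :
    HasDerivAt (cubicP a c k) (-2 * k * ξ - 3 * a * c * ξ ^ 2) ξ := by
  unfold cubicP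
  refine HasDerivAt.congr_deriv ((((hasDerivAt_pow 2 ξ).const_mul k).const_sub 1).fun_sub
    ((hasDerivAt_pow 3 ξ).const_mul (a * c))) ?_
  push_cast
  ring

theorem hasDerivAt_cubicP_deriv (a c k ξ : ℝ) :
    HasDerivAt (fun ξ => -2 * k * ξ - 3 * a * c * ξ ^ 2) (-2 * k - 6 * a * c * ξ) ξ := by
  refine HasDerivAt.congr_deriv (((hasDerivAt_id' ξ).const_mul (-2 * k)).fun_sub
    ((hasDerivAt_pow 2 ξ).const_mul (3 * a * c))) ?_
  push_cast
  ring

theorem hasDerivAt_cG (α : ℝ) {a b x : ℝ} (c k : ℝ) (hx : 0 < h a b x) :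
    HasDerivAt (cG α a b c k) (cG1 α a b c k x) x := by
  have he : cG α a b c k = fun x => cubicP a c k x * h a b x ^ (1 - expo α) :=
    funext (cG_eq α a b c k)
  rw [he]
  refine HasDerivAt.congr_deriv ((hasDerivAt_cubicP a c k x).fun_mul (hasDerivAt_h_rpow (1 - expo α) hx)) ?_
  unfold cG1
  ring

theorem hasDerivAt_cG1 (α : ℝ) {a b x : ℝ} (c k : ℝ) (hx : 0 < h a b x) :
    HasDerivAt (cG1 α a b c k) (cG2 α a b c k x) x := by
  unfold cG1
  refine HasDerivAt.congr_deriv (((hasDerivAt_cubicP_deriv a c k x).fun_add ((hasDerivAt_cubicP a c k x).fun_mul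
    ((hasDerivAt_h_log hx).const_mul (1 - expo α)))).fun_mul
    (hasDerivAt_h_rpow (1 - expo α) hx)) ?_
  unfold cG2
  ring

theorem hasDerivAt_cF (α : ℝ) {a b y : ℝ} (c k L : ℝ) (hy : 0 < h a b y) :
    HasDerivAt (cF α a b c k L) (cF1 α a b c k L y) y := by
  have he : cF α a b c k L = fun y => -cG α a b c k y + 1 / (a ^ 2 * L ^ 2) * h a b y ^ expo α :=
    funext (cF_eq α a b c k L)
  rw [he]
  exact (hasDerivAt_cG α c k hy).fun_neg.fun_add ((hasDerivAt_h_rpow _ hy).const_mul _)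

theorem hasDerivAt_cF1 (α : ℝ) {a b y : ℝ} (c k L : ℝ) (hy : 0 < h a b y) :
    HasDerivAt (cF1 α a b c k L) (cF2 α a b c k L y) y := by
  unfold cF1
  refine HasDerivAt.congr_deriv ((hasDerivAt_cG1 α c k hy).fun_neg.fun_add
    ((((hasDerivAt_h_log hy).const_mul (expo α)).fun_mul
      (hasDerivAt_h_rpow (expo α) hy)).const_mul (1 / (a ^ 2 * L ^ 2)))) ?_
  unfold cF2
  ring

/-- The argument is pointwise: continuity of `cF` and `cG` is used only where h > 0, so the set is
not written as an intersection of preimages under globally continuous maps. -/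
theorem isOpen_cDomain (α a b c k L : ℝ) : IsOpen (cDomain α a b c k L) := by
  rw [isOpen_iff_mem_nhds]
  rintro p ⟨h1, h2, h3, h4, h5⟩
  have c1 : ContinuousAt (fun q : Spacetime => q 2) p := (continuous_apply 2).continuousAt
  have c2 : ContinuousAt (fun q : Spacetime => q 1) p := (continuous_apply 1).continuousAt
  have c3 : ContinuousAt (fun q : Spacetime => h a b (q 2)) p :=
    ContinuousAt.comp (f := fun q : Spacetime => q 2) (hasDerivAt_h a b (p 2)).continuousAt c1
  have c4 : ContinuousAt (fun q : Spacetime => h a b (q 1)) p :=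
    ContinuousAt.comp (f := fun q : Spacetime => q 1) (hasDerivAt_h a b (p 1)).continuousAt c2
  have c5 : ContinuousAt (fun q : Spacetime => cF α a b c k L (q 1)) p :=
    ContinuousAt.comp (f := fun q : Spacetime => q 1)
      (hasDerivAt_cF α c k L h3).continuousAt c2
  have c6 : ContinuousAt (fun q : Spacetime => cG α a b c k (q 2)) p :=
    ContinuousAt.comp (f := fun q : Spacetime => q 2)
      (hasDerivAt_cG α c k h2).continuousAt c1
  filter_upwards [(c1.sub c2).eventually_ne (sub_ne_zero.2 h1), c3.eventually (lt_mem_nhds h2),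
    c4.eventually (lt_mem_nhds h3), c5.eventually_ne h4, c6.eventually (lt_mem_nhds h5)]
    with q q1 q2 q3 q4 q5
  exact ⟨sub_ne_zero.1 q1, q2, q3, q4, q5⟩

/-! The C-metric as a diagonal metric. -/

/-- The diagonal entries of the C-metric. -/
def cDiag (α a b c k L : ℝ) (i : Fin 4) (q : Spacetime) : ℝ :=
  1 / (a ^ 2 * (q 2 - q 1) ^ 2) *
    ![h a b (q 2) ^ expo α * (-cF α a b c k L (q 1)),
      h a b (q 2) ^ expo α * (1 / cF α a b c k L (q 1)),
      h a b (q 1) ^ expo α * (1 / cG α a b c k (q 2)),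
      h a b (q 1) ^ expo α * cG α a b c k (q 2)] i

/-- The logarithmic partial derivatives of the diagonal entries of the C-metric. -/
def cLogDeriv (α a b c k L : ℝ) (j i : Fin 4) (q : Spacetime) : ℝ :=
  ![0,
    ![2 / (q 2 - q 1) + cF1 α a b c k L (q 1) / cF α a b c k L (q 1),
      2 / (q 2 - q 1) - cF1 α a b c k L (q 1) / cF α a b c k L (q 1),
      2 / (q 2 - q 1) + expo α * (a * b / h a b (q 1)),
      2 / (q 2 - q 1) + expo α * (a * b / h a b (q 1))],
    ![-(2 / (q 2 - q 1)) + expo α * (a * b / h a b (q 2)),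
      -(2 / (q 2 - q 1)) + expo α * (a * b / h a b (q 2)),
      -(2 / (q 2 - q 1)) - cG1 α a b c k (q 2) / cG α a b c k (q 2),
      -(2 / (q 2 - q 1)) + cG1 α a b c k (q 2) / cG α a b c k (q 2)],
    0] j i

/-- The second logarithmic partial derivatives of the diagonal entries of the C-metric. -/
def cLogDeriv2 (α a b c k L : ℝ) (p : Spacetime) (m j i : Fin 4) : ℝ :=
  ![0,
    ![0,
      ![2 / (p 2 - p 1) ^ 2 + (cF2 α a b c k L (p 1) / cF α a b c k L (p 1)
          - (cF1 α a b c k L (p 1) / cF α a b c k L (p 1)) ^ 2),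
        2 / (p 2 - p 1) ^ 2 - (cF2 α a b c k L (p 1) / cF α a b c k L (p 1)
          - (cF1 α a b c k L (p 1) / cF α a b c k L (p 1)) ^ 2),
        2 / (p 2 - p 1) ^ 2 - expo α * (a * b / h a b (p 1)) ^ 2,
        2 / (p 2 - p 1) ^ 2 - expo α * (a * b / h a b (p 1)) ^ 2],
      fun _ => -2 / (p 2 - p 1) ^ 2,
      0],
    ![0,
      fun _ => -2 / (p 2 - p 1) ^ 2,
      ![2 / (p 2 - p 1) ^ 2 - expo α * (a * b / h a b (p 2)) ^ 2,
        2 / (p 2 - p 1) ^ 2 - expo α * (a * b / h a b (p 2)) ^ 2,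
        2 / (p 2 - p 1) ^ 2 - (cG2 α a b c k (p 2) / cG α a b c k (p 2)
          - (cG1 α a b c k (p 2) / cG α a b c k (p 2)) ^ 2),
        2 / (p 2 - p 1) ^ 2 + (cG2 α a b c k (p 2) / cG α a b c k (p 2)
          - (cG1 α a b c k (p 2) / cG α a b c k (p 2)) ^ 2)],
      0],
    0] m j i

theorem cMetric_eq (α a b c k L : ℝ) (q : Spacetime) :
    cMetric α a b c k L q = Matrix.diagonal (fun i => cDiag α a b c k L i q) := by
  rw [cMetric, ← Matrix.diagonal_smul]
  rfl

theorem cDiag_ne_zero {α a b c k L : ℝ} (ha : a ≠ 0) {q : Spacetime}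
    (hq : q ∈ cDomain α a b c k L) (i : Fin 4) : cDiag α a b c k L i q ≠ 0 := by
  obtain ⟨h1, h2, h3, h4, h5⟩ := hq
  have h1 := sub_ne_zero.2 h1
  have e2 := (Real.rpow_pos_of_pos h2 (expo α)).ne'
  have e3 := (Real.rpow_pos_of_pos h3 (expo α)).ne'
  have h5 := h5.ne'
  refine mul_ne_zero (by positivity) ?_
  fin_cases i <;> simp [*]

theorem hasPartialAt_cDiag {α a b c k L : ℝ} (ha : a ≠ 0) {q : Spacetime}
    (hq : q ∈ cDomain α a b c k L) (j i : Fin 4) :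
    HasPartialAt j (cDiag α a b c k L i)
      (cLogDeriv α a b c k L j i q * cDiag α a b c k L i q) q := by
  obtain ⟨h1, h2, h3, h4, h5⟩ := hq
  have h1 := sub_ne_zero.2 h1
  have h5 := h5.ne'
  have x1 : HasPartialAt j (fun q : Spacetime => q 2) (if j = 2 then 1 else 0) q :=
    HasPartialAt.of_hasDerivAt (hasDerivAt_id (q 2)) j
  have y1 : HasPartialAt j (fun q : Spacetime => q 1) (if j = 1 then 1 else 0) q :=
    HasPartialAt.of_hasDerivAt (hasDerivAt_id (q 1)) j
  have w := x1.sub y1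
  have A1 := HasPartialAt.of_hasDerivAt (p := q) (hasDerivAt_h_rpow (expo α) h2) j
  have B1 := HasPartialAt.of_hasDerivAt (p := q) (hasDerivAt_h_rpow (expo α) h3) j
  have F1 := HasPartialAt.of_hasDerivAt (p := q) (hasDerivAt_cF α c k L h3) j
  have G1 := HasPartialAt.of_hasDerivAt (p := q) (hasDerivAt_cG α c k h2) j
  have o := HasPartialAt.const j 1 q
  have Ω := o.div ((w.mul w).const_mul (a ^ 2)) (by positivity)
  have D0 := Ω.mul (A1.mul (F1.const_mul (-1)))
  have D1 := Ω.mul (A1.mul (o.div F1 h4))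
  have D2 := Ω.mul (B1.mul (o.div G1 h5))
  have D3 := Ω.mul (B1.mul G1)
  have e2 := h2.ne'
  have e3 := h3.ne'
  match i with
  | 0 =>
    convert D0 using 1
    · funext q; simp [cDiag, pow_two]
    · fin_cases j <;> simp [cDiag, cLogDeriv] <;> field_simp <;> ring
  | 1 =>
    convert D1 using 1
    · funext q; simp [cDiag, pow_two]
    · fin_cases j <;> simp [cDiag, cLogDeriv] <;> field_simp <;> ring
  | 2 =>
    convert D2 using 1
    · funext q; simp [cDiag, pow_two]
    · fin_cases j <;> simp [cDiag, cLogDeriv] <;> field_simp <;> ring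
  | 3 =>
    convert D3 using 1
    · funext q; simp [cDiag, pow_two]
    · fin_cases j <;> simp [cDiag, cLogDeriv] <;> field_simp <;> ring

theorem hasPartialAt_cLogDeriv {α a b c k L : ℝ} {q : Spacetime}
    (hq : q ∈ cDomain α a b c k L) (m j i : Fin 4) :
    HasPartialAt m (cLogDeriv α a b c k L j i) (cLogDeriv2 α a b c k L q m j i) q := by
  obtain ⟨h1, h2, h3, h4, h5⟩ := hq
  have h1 := sub_ne_zero.2 h1
  have h5 := h5.ne'
  have x1 : HasPartialAt m (fun q : Spacetime => q 2) (if m = 2 then 1 else 0) q :=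
    HasPartialAt.of_hasDerivAt (hasDerivAt_id (q 2)) m
  have y1 : HasPartialAt m (fun q : Spacetime => q 1) (if m = 1 then 1 else 0) q :=
    HasPartialAt.of_hasDerivAt (hasDerivAt_id (q 1)) m
  have w := (HasPartialAt.const m 2 q).div (x1.sub y1) h1
  have A1 := HasPartialAt.of_hasDerivAt (p := q) ((hasDerivAt_h_log h2).const_mul (expo α)) m
  have B1 := HasPartialAt.of_hasDerivAt (p := q) ((hasDerivAt_h_log h3).const_mul (expo α)) m
  have F1 := (HasPartialAt.of_hasDerivAt (p := q) (hasDerivAt_cF1 α c k L h3) m).div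
    (HasPartialAt.of_hasDerivAt (p := q) (hasDerivAt_cF α c k L h3) m) h4
  have G1 := (HasPartialAt.of_hasDerivAt (p := q) (hasDerivAt_cG1 α c k h2) m).div
    (HasPartialAt.of_hasDerivAt (p := q) (hasDerivAt_cG α c k h2) m) h5
  have o := HasPartialAt.const m 0 q
  have e2 := h2.ne'
  have e3 := h3.ne'
  have fin : ∀ {f f₁ : Spacetime → ℝ} {f' f₁' : ℝ}, HasPartialAt m f f' q → f₁ = f → f₁' = f' →
      HasPartialAt m f₁ f₁' q := fun hf h1 h2 => h1 ▸ h2 ▸ hf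
  match j, i with
  | 0, i =>
    refine fin o (by funext q; simp [cLogDeriv]) ?_
    fin_cases m <;> simp [cLogDeriv2]
  | 3, i =>
    refine fin o (by funext q; simp [cLogDeriv]) ?_
    fin_cases m <;> simp [cLogDeriv2]
  | 1, 0 =>
    refine fin (w.add F1) (by funext q; simp [cLogDeriv]) ?_
    fin_cases m <;> simp [cLogDeriv2]; field_simp
  | 1, 1 =>
    refine fin (w.sub F1) (by funext q; simp [cLogDeriv]) ?_
    fin_cases m <;> simp [cLogDeriv2]; field_simp
  | 1, 2 =>
    refine fin (w.add B1) (by funext q; simp [cLogDeriv]) ?_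
    fin_cases m <;> simp [cLogDeriv2]; ring
  | 1, 3 =>
    refine fin (w.add B1) (by funext q; simp [cLogDeriv]) ?_
    fin_cases m <;> simp [cLogDeriv2]; ring
  | 2, 0 =>
    refine fin ((w.const_mul (-1)).add A1) (by funext q; simp [cLogDeriv]) ?_
    fin_cases m <;> simp [cLogDeriv2]; ring; ring
  | 2, 1 =>
    refine fin ((w.const_mul (-1)).add A1) (by funext q; simp [cLogDeriv]) ?_
    fin_cases m <;> simp [cLogDeriv2]; ring; ring
  | 2, 2 =>
    refine fin ((w.const_mul (-1)).sub G1) (by funext q; simp [cLogDeriv]) ?_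
    fin_cases m <;> simp [cLogDeriv2]; ring; field_simp
  | 2, 3 =>
    refine fin ((w.const_mul (-1)).add G1) (by funext q; simp [cLogDeriv]) ?_
    fin_cases m <;> simp [cLogDeriv2]; ring; field_simp

/-- Openness of the domain supplies the neighbourhood on which the entries are nonzero and their
first derivatives are known. -/
theorem cMetric_jet {α a b c k L : ℝ} (ha : a ≠ 0) {p : Spacetime}
    (hp : p ∈ cDomain α a b c k L) :
    DiagonalJet (cMetric α a b c k L) (cDiag α a b c k L) (cLogDeriv α a b c k L)
      (cLogDeriv2 α a b c k L p) p := by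
  have hev : ∀ᶠ q in 𝓝 p, q ∈ cDomain α a b c k L := (isOpen_cDomain α a b c k L).mem_nhds hp
  exact ⟨cMetric_eq α a b c k L, hev.mono fun q hq => cDiag_ne_zero ha hq,
    hev.mono fun q hq => hasPartialAt_cDiag ha hq, hasPartialAt_cLogDeriv hp⟩

end EMD

/-! Curvature of four-dimensional diagonal metrics depending on the coordinates `1`, `2` only. -/

namespace Chart

/-- The logarithmic derivatives of a metric that depends on the coordinates `1` and `2` only. -/
structure TwoVariables (P : Fin 4 → Fin 4 → (Fin 4 → ℝ) → ℝ) (Q : Fin 4 → Fin 4 → Fin 4 → ℝ)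
    (p : Fin 4 → ℝ) : Prop where
  first_zero : ∀ i, P 0 i p = 0
  first_three : ∀ i, P 3 i p = 0
  left_zero : ∀ j i, Q 0 j i = 0
  left_three : ∀ j i, Q 3 j i = 0
  right_zero : ∀ j i, Q j 0 i = 0
  right_three : ∀ j i, Q j 3 i = 0
  symm : ∀ i, Q 2 1 i = Q 1 2 i

namespace DiagonalJet

variable {g : (Fin 4 → ℝ) → Matrix (Fin 4) (Fin 4) ℝ} {d : Fin 4 → (Fin 4 → ℝ) → ℝ}
  {P : Fin 4 → Fin 4 → (Fin 4 → ℝ) → ℝ} {Q : Fin 4 → Fin 4 → Fin 4 → ℝ} {p : Fin 4 → ℝ}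

/-- For a coordinate on which a diagonal metric does not depend, R₀₀ = -½ d₀ □ log |d₀|; the bracket
is this d'Alembertian, as in `box_two_variables`. The same holds for the index 3. -/
theorem ricci_zero_zero (hj : DiagonalJet g d P Q p) (ht : TwoVariables P Q p) :
    ricci g 0 0 p = d 0 p * (-(1 / 2) *
      ((Q 1 1 0 + P 1 0 p * ((P 1 0 p + P 1 1 p + P 1 2 p + P 1 3 p) / 2 - P 1 1 p)) / d 1 p
      + (Q 2 2 0 + P 2 0 p * ((P 2 0 p + P 2 1 p + P 2 2 p + P 2 3 p) / 2 - P 2 2 p))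
        / d 2 p)) := by
  have h1 := div_self (hj.ne_zero_self 1)
  have h2 := div_self (hj.ne_zero_self 2)
  rw [hj.ricci_eq]
  simp [Fin.sum_univ_four, diagChristoffel, diagChristoffelDeriv, ht.first_zero, ht.first_three,
    ht.left_zero, ht.left_three, ht.right_zero, h1, h2]
  ring

theorem ricci_three_three (hj : DiagonalJet g d P Q p) (ht : TwoVariables P Q p) :
    ricci g 3 3 p = d 3 p * (-(1 / 2) *
      ((Q 1 1 3 + P 1 3 p * ((P 1 0 p + P 1 1 p + P 1 2 p + P 1 3 p) / 2 - P 1 1 p)) / d 1 p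
      + (Q 2 2 3 + P 2 3 p * ((P 2 0 p + P 2 1 p + P 2 2 p + P 2 3 p) / 2 - P 2 2 p))
        / d 2 p)) := by
  have h1 := div_self (hj.ne_zero_self 1)
  have h2 := div_self (hj.ne_zero_self 2)
  rw [hj.ricci_eq]
  simp [Fin.sum_univ_four, diagChristoffel, diagChristoffelDeriv, ht.first_zero, ht.first_three,
    ht.left_zero, ht.left_three, ht.right_three, h1, h2]
  ring

theorem ricci_one_one (hj : DiagonalJet g d P Q p) (ht : TwoVariables P Q p) :
    ricci g 1 1 p = d 1 p * (-(1 / 2) *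
      ((Q 1 1 0 + Q 1 1 2 + Q 1 1 3 + (P 1 0 p * (P 1 0 p - P 1 1 p)
          + P 1 2 p * (P 1 2 p - P 1 1 p) + P 1 3 p * (P 1 3 p - P 1 1 p)) / 2) / d 1 p
      + (Q 2 2 1 + P 2 1 p * ((P 2 0 p + P 2 1 p + P 2 2 p + P 2 3 p) / 2 - P 2 2 p))
        / d 2 p)) := by
  have h1 := div_self (hj.ne_zero_self 1)
  have h2 := div_self (hj.ne_zero_self 2)
  have h0 := hj.ne_zero_self 1
  rw [hj.ricci_eq]
  simp [Fin.sum_univ_four, diagChristoffel, diagChristoffelDeriv, ht.first_zero, ht.first_three,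
    ht.left_zero, ht.left_three, h1, h2]
  field_simp
  ring

/-- The image of `ricci_one_one` under the exchange of the coordinates 1 and 2. -/
theorem ricci_two_two (hj : DiagonalJet g d P Q p) (ht : TwoVariables P Q p) :
    ricci g 2 2 p = d 2 p * (-(1 / 2) *
      ((Q 2 2 0 + Q 2 2 1 + Q 2 2 3 + (P 2 0 p * (P 2 0 p - P 2 2 p)
          + P 2 1 p * (P 2 1 p - P 2 2 p) + P 2 3 p * (P 2 3 p - P 2 2 p)) / 2) / d 2 p
      + (Q 1 1 2 + P 1 2 p * ((P 1 0 p + P 1 1 p + P 1 2 p + P 1 3 p) / 2 - P 1 1 p))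
        / d 1 p)) := by
  have h1 := div_self (hj.ne_zero_self 1)
  have h2 := div_self (hj.ne_zero_self 2)
  have h0 := hj.ne_zero_self 2
  rw [hj.ricci_eq]
  simp [Fin.sum_univ_four, diagChristoffel, diagChristoffelDeriv, ht.first_zero, ht.first_three,
    ht.left_zero, ht.left_three, h1, h2]
  field_simp
  ring

theorem ricci_one_two (hj : DiagonalJet g d P Q p) (ht : TwoVariables P Q p) :
    ricci g 1 2 p = -(1 / 2) * (Q 1 2 0 + Q 1 2 3)
      + (1 / 4) * (P 1 0 p * P 2 1 p + P 2 0 p * P 1 2 p - P 1 0 p * P 2 0 p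
        + P 1 3 p * P 2 1 p + P 2 3 p * P 1 2 p - P 1 3 p * P 2 3 p) := by
  have h1 := hj.ne_zero_self 1
  have h2 := hj.ne_zero_self 2
  rw [hj.ricci_eq]
  simp [Fin.sum_univ_four, diagChristoffel, diagChristoffelDeriv, ht.first_zero, ht.first_three,
    ht.symm]
  field_simp
  ring

/-- The only term of the Ricci tensor that is not visibly symmetric is ∂ₖΓⁱⱼᵢ = ∂ₖ∂ⱼ log √|det g|;
equality of the mixed derivatives, `ht.symm`, settles it. -/
theorem ricci_two_one (hj : DiagonalJet g d P Q p) (ht : TwoVariables P Q p) :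
    ricci g 2 1 p = ricci g 1 2 p := by
  have h1 := hj.ne_zero_self 1
  have h2 := hj.ne_zero_self 2
  rw [hj.ricci_one_two ht, hj.ricci_eq]
  simp [Fin.sum_univ_four, diagChristoffel, diagChristoffelDeriv, ht.first_zero, ht.first_three,
    ht.symm]
  field_simp
  ring

/-- Reflecting the coordinate 0 or 3 preserves the metric and changes the sign of these components.
-/
theorem ricci_off_diagonal (hj : DiagonalJet g d P Q p) (ht : TwoVariables P Q p)
    {i j : Fin 4} (hij : i ≠ j) (h12 : ¬(i = 1 ∧ j = 2)) (h21 : ¬(i = 2 ∧ j = 1)) :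
    ricci g i j p = 0 := by
  rw [hj.ricci_eq]
  fin_cases i <;> fin_cases j <;>
    first
    | exact absurd rfl hij
    | exact absurd ⟨rfl, rfl⟩ h12
    | exact absurd ⟨rfl, rfl⟩ h21
    | simp [Fin.sum_univ_four, diagChristoffel, diagChristoffelDeriv, ht.first_zero,
        ht.first_three, ht.left_zero, ht.left_three, ht.right_zero, ht.right_three]

/-- This is |g|^{-1/2} ∂ⱼ(|g|^{1/2} gʲʲ ∂ⱼφ): half the sum of the `P j i` over i is ∂ⱼ log
|g|^{1/2}, and -`P j j` comes from gʲʲ. The hypotheses `h0` and `h3` are equalities of functions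
because φ is differentiated twice. -/
theorem box_two_variables (hj : DiagonalJet g d P Q p) (ht : TwoVariables P Q p)
    {φ : (Fin 4 → ℝ) → ℝ} {φ₁ φ₂ φ₁₁ φ₂₂ : ℝ} (h0 : pd 0 φ = 0) (h3 : pd 3 φ = 0)
    (h1 : pd 1 φ p = φ₁) (h2 : pd 2 φ p = φ₂) (h11 : pd 1 (pd 1 φ) p = φ₁₁)
    (h22 : pd 2 (pd 2 φ) p = φ₂₂) :
    box g φ p =
      (φ₁₁ + φ₁ * ((P 1 0 p + P 1 1 p + P 1 2 p + P 1 3 p) / 2 - P 1 1 p)) / d 1 p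
      + (φ₂₂ + φ₂ * ((P 2 0 p + P 2 1 p + P 2 2 p + P 2 3 p) / 2 - P 2 2 p)) / d 2 p := by
  have e0 := hj.ne_zero_self 0
  have e1 := hj.ne_zero_self 1
  have e2 := hj.ne_zero_self 2
  have e3 := hj.ne_zero_self 3
  have p0 : pd 0 (0 : (Fin 4 → ℝ) → ℝ) p = 0 := (HasPartialAt.const 0 0 p).pd_eq
  have p3 : pd 3 (0 : (Fin 4 → ℝ) → ℝ) p = 0 := (HasPartialAt.const 3 0 p).pd_eq
  rw [hj.box_eq]
  simp [Fin.sum_univ_four, diagChristoffel, ht.first_zero, ht.first_three, h0, h1, h2, h3, h11,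
    h22, p0, p3]
  field_simp
  ring

end DiagonalJet

end Chart

/-! The field equations of the C-metric as identities between rational functions. -/

namespace EMD

/-- The relations between the values of the coefficient functions of the C-metric and of their
derivatives at a point. -/
structure Coefficients (a b c k u β x y A B X Y F F₁ F₂ G G₁ G₂ : ℝ) : Prop where
  a_ne : a ≠ 0
  A_ne : A ≠ 0
  B_ne : B ≠ 0
  X_ne : X ≠ 0
  Y_ne : Y ≠ 0
  F_ne : F ≠ 0
  G_ne : G ≠ 0
  w_ne : x - y ≠ 0
  X_eq : X = 1 + a * b * x
  Y_eq : Y = 1 + a * b * y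
  F_eq : F = -((1 - k * y ^ 2 - a * c * y ^ 3) * (Y / B)) + u * B
  F₁_eq : F₁ = -(((-2 * k * y - 3 * a * c * y ^ 2)
      + (1 - k * y ^ 2 - a * c * y ^ 3) * ((1 - β) * (a * b / Y))) * (Y / B))
      + u * (β * (a * b / Y) * B)
  F₂_eq : F₂ = -(((-2 * k - 6 * a * c * y)
      + 2 * (-2 * k * y - 3 * a * c * y ^ 2) * ((1 - β) * (a * b / Y))
      - (1 - k * y ^ 2 - a * c * y ^ 3) * ((1 - β) * β * (a * b / Y) ^ 2)) * (Y / B))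
      + u * (β * (β - 1) * (a * b / Y) ^ 2 * B)
  G_eq : G = (1 - k * x ^ 2 - a * c * x ^ 3) * (X / A)
  G₁_eq : G₁ = ((-2 * k * x - 3 * a * c * x ^ 2)
      + (1 - k * x ^ 2 - a * c * x ^ 3) * ((1 - β) * (a * b / X))) * (X / A)
  G₂_eq : G₂ = ((-2 * k - 6 * a * c * x)
      + 2 * (-2 * k * x - 3 * a * c * x ^ 2) * ((1 - β) * (a * b / X))
      - (1 - k * x ^ 2 - a * c * x ^ 3) * ((1 - β) * β * (a * b / X) ^ 2)) * (X / A)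

namespace Coefficients

variable {a b c k u β x y A B X Y F F₁ F₂ G G₁ G₂ : ℝ}

/-- The ττ equation divided by d₀. The left side is -½ □ log |d₀|; on the right stand the Maxwell
term, with e² = 2bc(2-β), and V/2, with u a² = 1/L². Nothing about A and B is used except that they
are nonzero. -/
theorem identity_zero (H : Coefficients a b c k u β x y A B X Y F F₁ F₂ G G₁ G₂) :
    -(1 / 2) *
      ((2 / (x - y) ^ 2 + (F₂ / F - (F₁ / F) ^ 2)
        + (2 / (x - y) + F₁ / F) * ((8 / (x - y) + 2 * (β * (a * b / Y))) / 2
          - (2 / (x - y) - F₁ / F))) / (1 / (a ^ 2 * (x - y) ^ 2) * (A * (1 / F)))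
      + (2 / (x - y) ^ 2 - β * (a * b / X) ^ 2
        + (-(2 / (x - y)) + β * (a * b / X)) * ((-(8 / (x - y)) + 2 * (β * (a * b / X))) / 2
          - (-(2 / (x - y)) - G₁ / G))) / (1 / (a ^ 2 * (x - y) ^ 2) * (B * (1 / G))))
      = -(1 / 4) * (A / B) * (2 * b * c * (2 - β)) * (a ^ 2 * (x - y) ^ 2 / A) ^ 2
        + (1 / 2) * (-(u * a ^ 2) * (B / A) * (β * (2 * β - 1) * (X / Y) ^ 2
          + 4 * β * (2 - β) * (X / Y) + (3 - 2 * β) * (2 - β))) := by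
  obtain ⟨ha, hA, hB, hX0, hY0, hF0, hG0, hw, hX, hY, hF, hF₁, hF₂, hG, hG₁, -⟩ := H
  -- The factor F from 1/d₁ cancels the denominators, and the squares (F₁/F)² cancel each other.
  -- What remains is linear in F, F₁, F₂, so their explicit values can be inserted without creating
  -- nested fractions.
  have e1 : (2 / (x - y) ^ 2 + (F₂ / F - (F₁ / F) ^ 2)
        + (2 / (x - y) + F₁ / F) * ((8 / (x - y) + 2 * (β * (a * b / Y))) / 2
          - (2 / (x - y) - F₁ / F))) / (1 / (a ^ 2 * (x - y) ^ 2) * (A * (1 / F)))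
      = (a ^ 2 * (x - y) ^ 2) / A * (F₂ + F₁ * (4 / (x - y) + β * (a * b / Y))
        + F * (6 / (x - y) ^ 2 + 2 / (x - y) * (β * (a * b / Y)))) := by
    field_simp
    ring
  have e2 : (2 / (x - y) ^ 2 - β * (a * b / X) ^ 2
        + (-(2 / (x - y)) + β * (a * b / X)) * ((-(8 / (x - y)) + 2 * (β * (a * b / X))) / 2
          - (-(2 / (x - y)) - G₁ / G))) / (1 / (a ^ 2 * (x - y) ^ 2) * (B * (1 / G)))
      = (a ^ 2 * (x - y) ^ 2) / B * (G * (2 / (x - y) ^ 2 - β * (a * b / X) ^ 2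
        + (-(2 / (x - y)) + β * (a * b / X)) * (-(2 / (x - y)) + β * (a * b / X)))
        + G₁ * (-(2 / (x - y)) + β * (a * b / X))) := by
    field_simp
    ring
  rw [e1, e2, hF₂, hF₁, hF, hG₁, hG]
  clear e1 e2 hF₂ hF₁ hF hG₁ hG
  field_simp
  -- X and Y are kept as nonzero atoms while denominators are cleared and are expanded only for the
  -- final polynomial identity.
  subst hX hY
  ring

/-- The yy equation divided by d₁. The additional last term is ½ (∂_yφ)²/d₁, with β(2-β) the square
of the dilaton coefficient; `identity_two` has its counterpart in x. -/
theorem identity_one (H : Coefficients a b c k u β x y A B X Y F F₁ F₂ G G₁ G₂) :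
    -(1 / 2) *
      ((2 / (x - y) ^ 2 + (F₂ / F - (F₁ / F) ^ 2) + 2 * (2 / (x - y) ^ 2 - β * (a * b / Y) ^ 2)
        + ((2 / (x - y) + F₁ / F) * (2 * (F₁ / F))
          + 2 * ((2 / (x - y) + β * (a * b / Y)) * (β * (a * b / Y) + F₁ / F))) / 2)
          / (1 / (a ^ 2 * (x - y) ^ 2) * (A * (1 / F)))
      + (2 / (x - y) ^ 2 - β * (a * b / X) ^ 2
        + (-(2 / (x - y)) + β * (a * b / X)) * ((-(8 / (x - y)) + 2 * (β * (a * b / X))) / 2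
          - (-(2 / (x - y)) - G₁ / G))) / (1 / (a ^ 2 * (x - y) ^ 2) * (B * (1 / G))))
      = -(1 / 4) * (A / B) * (2 * b * c * (2 - β)) * (a ^ 2 * (x - y) ^ 2 / A) ^ 2
        + (1 / 2) * (-(u * a ^ 2) * (B / A) * (β * (2 * β - 1) * (X / Y) ^ 2
          + 4 * β * (2 - β) * (X / Y) + (3 - 2 * β) * (2 - β)))
        + (1 / 2) * (β * (2 - β) * (a * b / Y) ^ 2)
          / (1 / (a ^ 2 * (x - y) ^ 2) * (A * (1 / F))) := by
  obtain ⟨ha, hA, hB, hX0, hY0, hF0, hG0, hw, hX, hY, hF, hF₁, hF₂, hG, hG₁, -⟩ := H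
  have e1 : (2 / (x - y) ^ 2 + (F₂ / F - (F₁ / F) ^ 2)
        + 2 * (2 / (x - y) ^ 2 - β * (a * b / Y) ^ 2)
        + ((2 / (x - y) + F₁ / F) * (2 * (F₁ / F))
          + 2 * ((2 / (x - y) + β * (a * b / Y)) * (β * (a * b / Y) + F₁ / F))) / 2)
          / (1 / (a ^ 2 * (x - y) ^ 2) * (A * (1 / F)))
      = (a ^ 2 * (x - y) ^ 2) / A * (F₂ + F₁ * (4 / (x - y) + β * (a * b / Y))
        + F * (6 / (x - y) ^ 2 - 2 * β * (a * b / Y) ^ 2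
          + (2 / (x - y) + β * (a * b / Y)) * (β * (a * b / Y)))) := by
    field_simp
    ring
  have e2 : (2 / (x - y) ^ 2 - β * (a * b / X) ^ 2
        + (-(2 / (x - y)) + β * (a * b / X)) * ((-(8 / (x - y)) + 2 * (β * (a * b / X))) / 2
          - (-(2 / (x - y)) - G₁ / G))) / (1 / (a ^ 2 * (x - y) ^ 2) * (B * (1 / G)))
      = (a ^ 2 * (x - y) ^ 2) / B * (G * (2 / (x - y) ^ 2 - β * (a * b / X) ^ 2
        + (-(2 / (x - y)) + β * (a * b / X)) * (-(2 / (x - y)) + β * (a * b / X)))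
        + G₁ * (-(2 / (x - y)) + β * (a * b / X))) := by
    field_simp
    ring
  have e3 : (1 / 2) * (β * (2 - β) * (a * b / Y) ^ 2)
          / (1 / (a ^ 2 * (x - y) ^ 2) * (A * (1 / F)))
      = (1 / 2) * (β * (2 - β) * (a * b / Y) ^ 2) * (a ^ 2 * (x - y) ^ 2 / A * F) := by
    field_simp
  rw [e1, e2, e3, hF₂, hF₁, hF, hG₁, hG]
  clear e1 e2 e3 hF₂ hF₁ hF hG₁ hG
  field_simp
  subst hX hY
  ring

theorem identity_two (H : Coefficients a b c k u β x y A B X Y F F₁ F₂ G G₁ G₂) :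
    -(1 / 2) *
      ((2 / (x - y) ^ 2 + (G₂ / G - (G₁ / G) ^ 2) + 2 * (2 / (x - y) ^ 2 - β * (a * b / X) ^ 2)
        + ((-(2 / (x - y)) + G₁ / G) * (2 * (G₁ / G))
          + 2 * ((-(2 / (x - y)) + β * (a * b / X)) * (β * (a * b / X) + G₁ / G))) / 2)
          / (1 / (a ^ 2 * (x - y) ^ 2) * (B * (1 / G)))
      + (2 / (x - y) ^ 2 - β * (a * b / Y) ^ 2
        + (2 / (x - y) + β * (a * b / Y)) * ((8 / (x - y) + 2 * (β * (a * b / Y))) / 2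
          - (2 / (x - y) - F₁ / F))) / (1 / (a ^ 2 * (x - y) ^ 2) * (A * (1 / F))))
      = (1 / 4) * (A / B) * (2 * b * c * (2 - β)) * (a ^ 2 * (x - y) ^ 2 / A) ^ 2
        + (1 / 2) * (-(u * a ^ 2) * (B / A) * (β * (2 * β - 1) * (X / Y) ^ 2
          + 4 * β * (2 - β) * (X / Y) + (3 - 2 * β) * (2 - β)))
        + (1 / 2) * (β * (2 - β) * (a * b / X) ^ 2)
          / (1 / (a ^ 2 * (x - y) ^ 2) * (B * (1 / G))) := by
  obtain ⟨ha, hA, hB, hX0, hY0, hF0, hG0, hw, hX, hY, hF, hF₁, -, hG, hG₁, hG₂⟩ := H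
  have e1 : (2 / (x - y) ^ 2 + (G₂ / G - (G₁ / G) ^ 2)
        + 2 * (2 / (x - y) ^ 2 - β * (a * b / X) ^ 2)
        + ((-(2 / (x - y)) + G₁ / G) * (2 * (G₁ / G))
          + 2 * ((-(2 / (x - y)) + β * (a * b / X)) * (β * (a * b / X) + G₁ / G))) / 2)
          / (1 / (a ^ 2 * (x - y) ^ 2) * (B * (1 / G)))
      = (a ^ 2 * (x - y) ^ 2) / B * (G₂ + G₁ * (-(4 / (x - y)) + β * (a * b / X))
        + G * (6 / (x - y) ^ 2 - 2 * β * (a * b / X) ^ 2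
          + (-(2 / (x - y)) + β * (a * b / X)) * (β * (a * b / X)))) := by
    field_simp
    ring
  have e2 : (2 / (x - y) ^ 2 - β * (a * b / Y) ^ 2
        + (2 / (x - y) + β * (a * b / Y)) * ((8 / (x - y) + 2 * (β * (a * b / Y))) / 2
          - (2 / (x - y) - F₁ / F))) / (1 / (a ^ 2 * (x - y) ^ 2) * (A * (1 / F)))
      = (a ^ 2 * (x - y) ^ 2) / A * (F * (2 / (x - y) ^ 2 - β * (a * b / Y) ^ 2
        + (2 / (x - y) + β * (a * b / Y)) * (2 / (x - y) + β * (a * b / Y)))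
        + F₁ * (2 / (x - y) + β * (a * b / Y))) := by
    field_simp
    ring
  have e3 : (1 / 2) * (β * (2 - β) * (a * b / X) ^ 2)
          / (1 / (a ^ 2 * (x - y) ^ 2) * (B * (1 / G)))
      = (1 / 2) * (β * (2 - β) * (a * b / X) ^ 2) * (a ^ 2 * (x - y) ^ 2 / B * G) := by
    field_simp
  rw [e1, e2, e3, hF₁, hF, hG₂, hG₁, hG]
  clear e1 e2 e3 hF₁ hF hG₂ hG₁ hG
  field_simp
  subst hX hY
  ring

theorem identity_three (H : Coefficients a b c k u β x y A B X Y F F₁ F₂ G G₁ G₂) :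
    -(1 / 2) *
      ((2 / (x - y) ^ 2 - β * (a * b / Y) ^ 2
        + (2 / (x - y) + β * (a * b / Y)) * ((8 / (x - y) + 2 * (β * (a * b / Y))) / 2
          - (2 / (x - y) - F₁ / F))) / (1 / (a ^ 2 * (x - y) ^ 2) * (A * (1 / F)))
      + (2 / (x - y) ^ 2 + (G₂ / G - (G₁ / G) ^ 2)
        + (-(2 / (x - y)) + G₁ / G) * ((-(8 / (x - y)) + 2 * (β * (a * b / X))) / 2
          - (-(2 / (x - y)) - G₁ / G))) / (1 / (a ^ 2 * (x - y) ^ 2) * (B * (1 / G))))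
      = (1 / 4) * (A / B) * (2 * b * c * (2 - β)) * (a ^ 2 * (x - y) ^ 2 / A) ^ 2
        + (1 / 2) * (-(u * a ^ 2) * (B / A) * (β * (2 * β - 1) * (X / Y) ^ 2
          + 4 * β * (2 - β) * (X / Y) + (3 - 2 * β) * (2 - β))) := by
  obtain ⟨ha, hA, hB, hX0, hY0, hF0, hG0, hw, hX, hY, hF, hF₁, -, hG, hG₁, hG₂⟩ := H
  have e1 : (2 / (x - y) ^ 2 + (G₂ / G - (G₁ / G) ^ 2)
        + (-(2 / (x - y)) + G₁ / G) * ((-(8 / (x - y)) + 2 * (β * (a * b / X))) / 2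
          - (-(2 / (x - y)) - G₁ / G))) / (1 / (a ^ 2 * (x - y) ^ 2) * (B * (1 / G)))
      = (a ^ 2 * (x - y) ^ 2) / B * (G₂ + G₁ * (-(4 / (x - y)) + β * (a * b / X))
        + G * (6 / (x - y) ^ 2 - 2 / (x - y) * (β * (a * b / X)))) := by
    field_simp
    ring
  have e2 : (2 / (x - y) ^ 2 - β * (a * b / Y) ^ 2
        + (2 / (x - y) + β * (a * b / Y)) * ((8 / (x - y) + 2 * (β * (a * b / Y))) / 2
          - (2 / (x - y) - F₁ / F))) / (1 / (a ^ 2 * (x - y) ^ 2) * (A * (1 / F)))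
      = (a ^ 2 * (x - y) ^ 2) / A * (F * (2 / (x - y) ^ 2 - β * (a * b / Y) ^ 2
        + (2 / (x - y) + β * (a * b / Y)) * (2 / (x - y) + β * (a * b / Y)))
        + F₁ * (2 / (x - y) + β * (a * b / Y))) := by
    field_simp
    ring
  rw [e1, e2, hF₁, hF, hG₂, hG₁, hG]
  clear e1 e2 hF₁ hF hG₂ hG₁ hG
  field_simp
  subst hX hY
  ring

/-- The terms with F₁/F and G₁/G cancel. The rest follows from ab/X - ab/Y = -(x-y)(ab/X)(ab/Y). -/
theorem identity_one_two (H : Coefficients a b c k u β x y A B X Y F F₁ F₂ G G₁ G₂) :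
    -(1 / 2) * (-2 / (x - y) ^ 2 + -2 / (x - y) ^ 2)
      + (1 / 4) * ((2 / (x - y) + F₁ / F) * (-(2 / (x - y)) + β * (a * b / X))
        + (-(2 / (x - y)) + β * (a * b / X)) * (2 / (x - y) + β * (a * b / Y))
        - (2 / (x - y) + F₁ / F) * (-(2 / (x - y)) + β * (a * b / X))
        + (2 / (x - y) + β * (a * b / Y)) * (-(2 / (x - y)) + β * (a * b / X))
        + (-(2 / (x - y)) + G₁ / G) * (2 / (x - y) + β * (a * b / Y))
        - (2 / (x - y) + β * (a * b / Y)) * (-(2 / (x - y)) + G₁ / G))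
      = -(1 / 2) * (β * (2 - β) * (a * b / Y) * (a * b / X)) := by
  obtain ⟨ha, hA, hB, hX0, hY0, hF0, hG0, hw, hX, hY, hF, hF₁, -, hG, hG₁, hG₂⟩ := H
  clear hF hF₁ hG hG₁ hG₂
  field_simp
  subst hX hY
  ring

/-- The dilaton equation for log (Y/X), after the common factor 2α/(1+α²) has been divided out. -/
theorem identity_box (H : Coefficients a b c k u β x y A B X Y F F₁ F₂ G G₁ G₂) :
    (-(a * b / Y) ^ 2 + (a * b / Y) * ((8 / (x - y) + 2 * (β * (a * b / Y))) / 2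
          - (2 / (x - y) - F₁ / F))) / (1 / (a ^ 2 * (x - y) ^ 2) * (A * (1 / F)))
      + ((a * b / X) ^ 2 + -(a * b / X) * ((-(8 / (x - y)) + 2 * (β * (a * b / X))) / 2
          - (-(2 / (x - y)) - G₁ / G))) / (1 / (a ^ 2 * (x - y) ^ 2) * (B * (1 / G)))
      = -(u * a ^ 2) * (B / A) * (-(2 * β - 1) * (X / Y) ^ 2
          + 4 * (β - 1) * (X / Y) + (3 - 2 * β))
        + (A / B) * (b * c) * (a ^ 2 * (x - y) ^ 2 / A) ^ 2 := by
  obtain ⟨ha, hA, hB, hX0, hY0, hF0, hG0, hw, hX, hY, hF, hF₁, -, hG, hG₁, -⟩ := H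
  have e1 : (-(a * b / Y) ^ 2 + (a * b / Y) * ((8 / (x - y) + 2 * (β * (a * b / Y))) / 2
          - (2 / (x - y) - F₁ / F))) / (1 / (a ^ 2 * (x - y) ^ 2) * (A * (1 / F)))
      = (a ^ 2 * (x - y) ^ 2) / A * (F * (-(a * b / Y) ^ 2
        + (a * b / Y) * (2 / (x - y) + β * (a * b / Y))) + F₁ * (a * b / Y)) := by
    field_simp
    ring
  have e2 : ((a * b / X) ^ 2 + -(a * b / X) * ((-(8 / (x - y)) + 2 * (β * (a * b / X))) / 2
          - (-(2 / (x - y)) - G₁ / G))) / (1 / (a ^ 2 * (x - y) ^ 2) * (B * (1 / G)))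
      = (a ^ 2 * (x - y) ^ 2) / B * (G * ((a * b / X) ^ 2
        - (a * b / X) * (-(2 / (x - y)) + β * (a * b / X))) - G₁ * (a * b / X)) := by
    field_simp
    ring
  rw [e1, e2, hF₁, hF, hG₁, hG]
  clear e1 e2 hF₁ hF hG₁ hG
  field_simp
  subst hX hY
  ring

end Coefficients

end EMD

/-! The C-metric solves the Einstein-Maxwell-dilaton system. -/

namespace EMD

open Chart

variable {α a b c k L : ℝ} {p : Spacetime}

/-- The passage from real powers to rational functions: h^(1-β) = h/h^β is the only property of the
powers used besides positivity. -/
theorem coefficients (ha : a ≠ 0) (hp : p ∈ cDomain α a b c k L) :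
    Coefficients a b c k (1 / (a ^ 2 * L ^ 2)) (expo α) (p 2) (p 1) (h a b (p 2) ^ expo α)
      (h a b (p 1) ^ expo α) (h a b (p 2)) (h a b (p 1)) (cF α a b c k L (p 1))
      (cF1 α a b c k L (p 1)) (cF2 α a b c k L (p 1)) (cG α a b c k (p 2))
      (cG1 α a b c k (p 2)) (cG2 α a b c k (p 2)) := by
  obtain ⟨h1, h2, h3, h4, h5⟩ := hp
  refine ⟨ha, (Real.rpow_pos_of_pos h2 _).ne', (Real.rpow_pos_of_pos h3 _).ne', h2.ne', h3.ne',
    h4, h5.ne', sub_ne_zero.2 h1, rfl, rfl, ?_, ?_, ?_, ?_, ?_, ?_⟩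
  · rw [cF_eq, cG_eq, h_rpow_one_sub_expo α h3, cubicP]
  · rw [cF1, cG1, h_rpow_one_sub_expo α h3, cubicP]
  · rw [cF2, cG2, h_rpow_one_sub_expo α h3, cubicP]
  · rw [cG_eq, h_rpow_one_sub_expo α h2, cubicP]
  · rw [cG1, h_rpow_one_sub_expo α h2, cubicP]
  · rw [cG2, h_rpow_one_sub_expo α h2, cubicP]

theorem twoVariables_cLogDeriv (p : Spacetime) :
    TwoVariables (cLogDeriv α a b c k L) (cLogDeriv2 α a b c k L p) p where
  first_zero i := by simp [cLogDeriv]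
  first_three i := by simp [cLogDeriv]
  left_zero j i := by simp [cLogDeriv2]
  left_three j i := by simp [cLogDeriv2]
  right_zero j i := by fin_cases j <;> simp [cLogDeriv2]
  right_three j i := by fin_cases j <;> simp [cLogDeriv2]
  symm i := by simp [cLogDeriv2]

/-! The dilaton. -/

theorem exp_mul_cDilaton (s : ℝ) (hx : 0 < h a b (p 2)) (hy : 0 < h a b (p 1)) :
    Real.exp (s * cDilaton α a b p)
      = (h a b (p 1) / h a b (p 2)) ^ (s * (2 * α / (1 + α ^ 2))) := by
  rw [Real.rpow_def_of_pos (div_pos hy hx), cDilaton]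
  congr 1
  ring

theorem exp_alpha_mul_cDilaton (hx : 0 < h a b (p 2)) (hy : 0 < h a b (p 1)) :
    Real.exp (α * cDilaton α a b p) = (h a b (p 1) / h a b (p 2)) ^ expo α := by
  rw [exp_mul_cDilaton α hx hy, expo]
  congr 1
  ring

theorem exp_alpha_mul_cDilaton' (hx : 0 < h a b (p 2)) (hy : 0 < h a b (p 1)) :
    Real.exp (α * cDilaton α a b p) = h a b (p 1) ^ expo α / h a b (p 2) ^ expo α := by
  rw [exp_alpha_mul_cDilaton hx hy, Real.div_rpow hy.le hx.le]

theorem exp_neg_alpha_mul_cDilaton (hx : 0 < h a b (p 2)) (hy : 0 < h a b (p 1)) :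
    Real.exp (-α * cDilaton α a b p) = h a b (p 2) ^ expo α / h a b (p 1) ^ expo α := by
  rw [neg_mul, Real.exp_neg, exp_alpha_mul_cDilaton' hx hy, inv_div]

theorem exp_neg_cDilaton_div (hα : α ≠ 0) (hx : 0 < h a b (p 2)) (hy : 0 < h a b (p 1)) :
    Real.exp (-cDilaton α a b p / α)
      = h a b (p 1) ^ expo α / h a b (p 2) ^ expo α * (h a b (p 2) / h a b (p 1)) ^ 2 := by
  have hα' := (one_add_sq_pos α).ne'
  have e : -cDilaton α a b p / α = (-1 / α) * cDilaton α a b p := by ring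
  have e' : (-1 / α) * (2 * α / (1 + α ^ 2)) = expo α - 2 := by
    unfold expo
    field_simp
    ring
  rw [e, exp_mul_cDilaton _ hx hy, e', ← Real.div_rpow hy.le hx.le,
    Real.rpow_sub (div_pos hy hx), Real.rpow_two]
  field_simp

theorem exp_mul_cDilaton_div_two (hα : α ≠ 0) (hx : 0 < h a b (p 2)) (hy : 0 < h a b (p 1)) :
    Real.exp ((α - 1 / α) * cDilaton α a b p / 2)
      = h a b (p 1) ^ expo α / h a b (p 2) ^ expo α * (h a b (p 2) / h a b (p 1)) := by
  have hα' := (one_add_sq_pos α).ne'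
  have e : (α - 1 / α) * cDilaton α a b p / 2 = ((α - 1 / α) / 2) * cDilaton α a b p := by ring
  have e' : ((α - 1 / α) / 2) * (2 * α / (1 + α ^ 2)) = expo α - 1 := by
    unfold expo
    field_simp
    ring
  rw [e, exp_mul_cDilaton _ hx hy, e', ← Real.div_rpow hy.le hx.le,
    Real.rpow_sub (div_pos hy hx), Real.rpow_one]
  field_simp

/-- The three exponentials are the powers β - 2, β - 1 and β of h_y/h_x, and the coefficients of V
become polynomials in β. -/
theorem potential_cDilaton (ha : a ≠ 0) (hL : L ≠ 0) (hx : 0 < h a b (p 2)) (hy : 0 < h a b (p 1)) :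
    potential α L (cDilaton α a b p) = -(1 / (a ^ 2 * L ^ 2) * a ^ 2)
      * (h a b (p 1) ^ expo α / h a b (p 2) ^ expo α)
      * (expo α * (2 * expo α - 1) * (h a b (p 2) / h a b (p 1)) ^ 2
        + 4 * expo α * (2 - expo α) * (h a b (p 2) / h a b (p 1))
        + (3 - 2 * expo α) * (2 - expo α)) := by
  have hα' := (one_add_sq_pos α).ne'
  rw [potential, exp_alpha_mul_cDilaton' hx hy]
  -- With the convention 1/0 = 0 the formulas for the first two exponentials fail at α = 0, but
  -- these terms carry the factor α² = 0.
  by_cases hα : α = 0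
  · subst hα
    simp [expo]
    field_simp
  · rw [exp_neg_cDilaton_div hα hx hy, exp_mul_cDilaton_div_two hα hx hy]
    generalize h a b (p 1) ^ expo α / h a b (p 2) ^ expo α = E
    generalize h a b (p 2) / h a b (p 1) = t
    unfold expo
    field_simp
    ring

theorem hasDerivAt_potential (α L φ : ℝ) :
    HasDerivAt (potential α L) (-(2 / ((1 + α ^ 2) ^ 2 * L ^ 2)) *
      (α ^ 2 * (3 * α ^ 2 - 1) * (Real.exp (-φ / α) * (-1 / α))
      + 8 * α ^ 2 * (Real.exp ((α - 1 / α) * φ / 2) * ((α - 1 / α) / 2))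
      + (3 - α ^ 2) * (Real.exp (α * φ) * α))) φ := by
  have h1 : HasDerivAt (fun φ : ℝ => -φ / α) (-1 / α) φ := (hasDerivAt_id' φ).fun_neg.div_const α
  have h2 : HasDerivAt (fun φ : ℝ => (α - 1 / α) * φ / 2) ((α - 1 / α) / 2) φ := by
    simpa using ((hasDerivAt_id' φ).const_mul (α - 1 / α)).div_const 2
  have h3 : HasDerivAt (fun φ : ℝ => α * φ) α φ := by
    simpa using (hasDerivAt_id' φ).const_mul α
  exact (((h1.exp.const_mul _).fun_add (h2.exp.const_mul _)).fun_add
    (h3.exp.const_mul _)).const_mul _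

theorem deriv_potential_cDilaton (ha : a ≠ 0) (hL : L ≠ 0) (hx : 0 < h a b (p 2)) (hy : 0 < h a b (p 1)) :
    deriv (potential α L) (cDilaton α a b p) = 2 * α / (1 + α ^ 2) *
      (-(1 / (a ^ 2 * L ^ 2) * a ^ 2)
      * (h a b (p 1) ^ expo α / h a b (p 2) ^ expo α)
      * (-(2 * expo α - 1) * (h a b (p 2) / h a b (p 1)) ^ 2
        + 4 * (expo α - 1) * (h a b (p 2) / h a b (p 1))
        + (3 - 2 * expo α))) := by
  have hα' := (one_add_sq_pos α).ne'
  rw [(hasDerivAt_potential α L _).deriv, exp_alpha_mul_cDilaton' hx hy]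
  by_cases hα : α = 0
  · subst hα
    simp
  · rw [exp_neg_cDilaton_div hα hx hy, exp_mul_cDilaton_div_two hα hx hy]
    generalize h a b (p 1) ^ expo α / h a b (p 2) ^ expo α = E
    generalize h a b (p 2) / h a b (p 1) = t
    unfold expo
    field_simp
    ring

theorem hasPartialAt_cDilaton (hx : 0 < h a b (p 2)) (hy : 0 < h a b (p 1)) (j : Fin 4) :
    HasPartialAt j (cDilaton α a b)
      (![0, 2 * α / (1 + α ^ 2) * (a * b / h a b (p 1)),
        2 * α / (1 + α ^ 2) * -(a * b / h a b (p 2)), 0] j) p := by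
  have x1 := HasPartialAt.of_hasDerivAt (p := p) (hasDerivAt_h a b (p 2)) j
  have y1 := HasPartialAt.of_hasDerivAt (p := p) (hasDerivAt_h a b (p 1)) j
  have := ((y1.div x1 hx.ne').log (div_pos hy hx).ne').const_mul (2 * α / (1 + α ^ 2))
  have hx' := hx.ne'
  have hy' := hy.ne'
  refine HasDerivAt.congr_deriv this ?_
  fin_cases j <;> simp
  · left
    field_simp
  · field_simp

/-! The field strength. -/

theorem fieldStrength_cGauge (i j : Fin 4) (q : Spacetime) :
    fieldStrength (cGauge α b c) i j q = 2 * Real.sqrt (b * c / (1 + α ^ 2)) *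
      ((if i = 1 ∧ j = 0 then 1 else 0) - if j = 1 ∧ i = 0 then 1 else 0) := by
  have key : ∀ m l : Fin 4, pd m (fun q => cGauge α b c q l) q
      = 2 * Real.sqrt (b * c / (1 + α ^ 2)) * if m = 1 ∧ l = 0 then 1 else 0 := by
    intro m l
    by_cases hl : l = 0
    · subst hl
      have := HasPartialAt.of_hasDerivAt (p := q)
        ((hasDerivAt_id' (q 1)).const_mul (2 * Real.sqrt (b * c / (1 + α ^ 2)))) m
      refine (HasPartialAt.pd_eq this).trans ?_
      simp
    · have h0 : (fun q : Spacetime => cGauge α b c q l) = fun _ => 0 := by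
        funext q
        fin_cases l <;> simp_all [cGauge]
      rw [h0, (HasPartialAt.const m 0 q).pd_eq]
      simp [hl]
  rw [fieldStrength, key, key]
  ring

/-- Here the sign condition on bc makes the square root genuine; 2 - β = 2/(1+α²). -/
theorem cGauge_coefficient_sq (hbc : 0 ≤ b * c) :
    (2 * Real.sqrt (b * c / (1 + α ^ 2))) ^ 2 = 2 * b * c * (2 - expo α) := by
  have hα' := one_add_sq_pos α
  rw [mul_pow, Real.sq_sqrt (div_nonneg hbc hα'.le), expo]
  have := hα'.ne'
  field_simp
  ring

/-- Only F_{yτ} and F_{τy} are nonzero, and they contribute equally. -/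
theorem fieldStrengthSq_cGauge {g : Spacetime → Matrix (Fin 4) (Fin 4) ℝ}
    {d : Fin 4 → Spacetime → ℝ} {P : Fin 4 → Fin 4 → Spacetime → ℝ}
    {Q : Fin 4 → Fin 4 → Fin 4 → ℝ} (hj : DiagonalJet g d P Q p) :
    fieldStrengthSq g (cGauge α b c) p
      = 2 * (2 * Real.sqrt (b * c / (1 + α ^ 2))) ^ 2 / (d 0 p * d 1 p) := by
  have h0 := hj.ne_zero_self 0
  have h1 := hj.ne_zero_self 1
  simp only [fieldStrengthSq, hj.fieldStrengthUp_eq _ _ _ hj.ne_zero_self, fieldStrength_cGauge]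
  simp [Fin.sum_univ_four]
  field_simp
  ring

/-! The Ricci tensor. -/

/-- F cancels in g_ττ g_yy. Hence F² is free of F, and the product is negative whichever sign F has.
-/
theorem cDiag_zero_mul_one (hp : p ∈ cDomain α a b c k L) :
    cDiag α a b c k L 0 p * cDiag α a b c k L 1 p
      = -(a ^ 2 * (p 2 - p 1) ^ 2 / h a b (p 2) ^ expo α)⁻¹ ^ 2 := by
  have h4 := hp.2.2.2.1
  simp only [cDiag, Matrix.cons_val_zero, Matrix.cons_val_one]
  field_simp

/-- The electromagnetic contribution to the Ricci tensor of the C-metric. -/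
def cStress (α a b c k L : ℝ) (p : Spacetime) : ℝ :=
  (1 / 4) * Real.exp (-α * cDilaton α a b p) * (2 * Real.sqrt (b * c / (1 + α ^ 2))) ^ 2
    / (cDiag α a b c k L 0 p * cDiag α a b c k L 1 p)

theorem cStress_eq (hbc : 0 ≤ b * c) (hp : p ∈ cDomain α a b c k L) :
    cStress α a b c k L p = -(1 / 4) * (h a b (p 2) ^ expo α / h a b (p 1) ^ expo α)
      * (2 * b * c * (2 - expo α)) * (a ^ 2 * (p 2 - p 1) ^ 2 / h a b (p 2) ^ expo α) ^ 2 := by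
  rw [cStress, cDiag_zero_mul_one hp, exp_neg_alpha_mul_cDilaton hp.2.1 hp.2.2.1,
    cGauge_coefficient_sq hbc, inv_pow, div_neg, div_inv_eq_mul]
  ring

theorem neg_cStress_eq (hbc : 0 ≤ b * c) (hp : p ∈ cDomain α a b c k L) :
    -cStress α a b c k L p = (1 / 4) * (h a b (p 2) ^ expo α / h a b (p 1) ^ expo α)
      * (2 * b * c * (2 - expo α)) * (a ^ 2 * (p 2 - p 1) ^ 2 / h a b (p 2) ^ expo α) ^ 2 := by
  rw [cStress_eq hbc hp]
  ring

theorem dilaton_coefficient_sq (α : ℝ) :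
    (2 * α / (1 + α ^ 2)) ^ 2 = expo α * (2 - expo α) := by
  have := (one_add_sq_pos α).ne'
  unfold expo
  field_simp
  ring

theorem ricci_cMetric_zero_zero (ha : a ≠ 0) (hL : L ≠ 0) (hbc : 0 ≤ b * c)
    (hp : p ∈ cDomain α a b c k L) :
    ricci (cMetric α a b c k L) 0 0 p = cDiag α a b c k L 0 p *
      (cStress α a b c k L p + (1 / 2) * potential α L (cDilaton α a b p)) := by
  rw [(cMetric_jet ha hp).ricci_zero_zero (twoVariables_cLogDeriv p), cStress_eq hbc hp,
    potential_cDilaton ha hL hp.2.1 hp.2.2.1, ← (coefficients ha hp).identity_zero]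
  congr 3 <;> simp [cLogDeriv, cLogDeriv2, cDiag] <;> ring

theorem ricci_cMetric_one_one (ha : a ≠ 0) (hL : L ≠ 0) (hbc : 0 ≤ b * c)
    (hp : p ∈ cDomain α a b c k L) :
    ricci (cMetric α a b c k L) 1 1 p = cDiag α a b c k L 1 p *
      (cStress α a b c k L p + (1 / 2) * potential α L (cDilaton α a b p))
      + (1 / 2) * (pd 1 (cDilaton α a b) p * pd 1 (cDilaton α a b) p) := by
  have hd := (cMetric_jet ha hp).ne_zero_self 1
  -- Moves the dilaton gradient inside the bracket, so that both sides have the factor d₁ and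
  -- `identity_one` applies to the other factor.
  have e : ∀ s : ℝ, cDiag α a b c k L 1 p * s
      + (1 / 2) * (pd 1 (cDilaton α a b) p * pd 1 (cDilaton α a b) p)
      = cDiag α a b c k L 1 p * (s + (1 / 2)
        * (pd 1 (cDilaton α a b) p * pd 1 (cDilaton α a b) p) / cDiag α a b c k L 1 p) := by
    intro s
    field_simp
  have e' : pd 1 (cDilaton α a b) p * pd 1 (cDilaton α a b) p
      = expo α * (2 - expo α) * (a * b / h a b (p 1)) ^ 2 := by
    rw [(hasPartialAt_cDilaton hp.2.1 hp.2.2.1 1).pd_eq, ← dilaton_coefficient_sq]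
    simp
    ring
  have e'' : cDiag α a b c k L 1 p = 1 / (a ^ 2 * (p 2 - p 1) ^ 2)
      * (h a b (p 2) ^ expo α * (1 / cF α a b c k L (p 1))) := rfl
  rw [e, e', (cMetric_jet ha hp).ricci_one_one (twoVariables_cLogDeriv p), cStress_eq hbc hp,
    potential_cDilaton ha hL hp.2.1 hp.2.2.1, e'', ← (coefficients ha hp).identity_one]
  congr 3 <;> simp [cLogDeriv, cLogDeriv2, cDiag] <;> ring

theorem ricci_cMetric_two_two (ha : a ≠ 0) (hL : L ≠ 0) (hbc : 0 ≤ b * c)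
    (hp : p ∈ cDomain α a b c k L) :
    ricci (cMetric α a b c k L) 2 2 p = cDiag α a b c k L 2 p *
      (-cStress α a b c k L p + (1 / 2) * potential α L (cDilaton α a b p))
      + (1 / 2) * (pd 2 (cDilaton α a b) p * pd 2 (cDilaton α a b) p) := by
  have hd := (cMetric_jet ha hp).ne_zero_self 2
  have e : ∀ s : ℝ, cDiag α a b c k L 2 p * s
      + (1 / 2) * (pd 2 (cDilaton α a b) p * pd 2 (cDilaton α a b) p)
      = cDiag α a b c k L 2 p * (s + (1 / 2)
        * (pd 2 (cDilaton α a b) p * pd 2 (cDilaton α a b) p) / cDiag α a b c k L 2 p) := by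
    intro s
    field_simp
  have e' : pd 2 (cDilaton α a b) p * pd 2 (cDilaton α a b) p
      = expo α * (2 - expo α) * (a * b / h a b (p 2)) ^ 2 := by
    rw [(hasPartialAt_cDilaton hp.2.1 hp.2.2.1 2).pd_eq, ← dilaton_coefficient_sq]
    simp
    ring
  have e'' : cDiag α a b c k L 2 p = 1 / (a ^ 2 * (p 2 - p 1) ^ 2)
      * (h a b (p 1) ^ expo α * (1 / cG α a b c k (p 2))) := rfl
  rw [e, e', (cMetric_jet ha hp).ricci_two_two (twoVariables_cLogDeriv p), neg_cStress_eq hbc hp,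
    potential_cDilaton ha hL hp.2.1 hp.2.2.1, e'', ← (coefficients ha hp).identity_two]
  congr 3 <;> simp [cLogDeriv, cLogDeriv2, cDiag] <;> ring

theorem ricci_cMetric_three_three (ha : a ≠ 0) (hL : L ≠ 0) (hbc : 0 ≤ b * c)
    (hp : p ∈ cDomain α a b c k L) :
    ricci (cMetric α a b c k L) 3 3 p = cDiag α a b c k L 3 p *
      (-cStress α a b c k L p + (1 / 2) * potential α L (cDilaton α a b p)) := by
  rw [(cMetric_jet ha hp).ricci_three_three (twoVariables_cLogDeriv p), neg_cStress_eq hbc hp,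
    potential_cDilaton ha hL hp.2.1 hp.2.2.1, ← (coefficients ha hp).identity_three]
  congr 3 <;> simp [cLogDeriv, cLogDeriv2, cDiag] <;> ring

theorem ricci_cMetric_one_two (ha : a ≠ 0) (hp : p ∈ cDomain α a b c k L) :
    ricci (cMetric α a b c k L) 1 2 p
      = (1 / 2) * (pd 1 (cDilaton α a b) p * pd 2 (cDilaton α a b) p) := by
  have e : pd 1 (cDilaton α a b) p * pd 2 (cDilaton α a b) p
      = -(expo α * (2 - expo α) * (a * b / h a b (p 1)) * (a * b / h a b (p 2))) := by
    rw [(hasPartialAt_cDilaton hp.2.1 hp.2.2.1 1).pd_eq,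
      (hasPartialAt_cDilaton hp.2.1 hp.2.2.1 2).pd_eq, ← dilaton_coefficient_sq]
    simp
    ring
  rw [e, mul_neg, ← neg_mul, ← (coefficients ha hp).identity_one_two,
    (cMetric_jet ha hp).ricci_one_two (twoVariables_cLogDeriv p)]
  simp [cLogDeriv, cLogDeriv2]

theorem pd_cDilaton_eq_zero {j : Fin 4} (h1 : j ≠ 1) (h2 : j ≠ 2) :
    pd j (cDilaton α a b) = 0 := by
  funext q
  simp [pd, cDilaton, Function.update_of_ne h1.symm, Function.update_of_ne h2.symm]

theorem pd_one_pd_one_cDilaton (hp : p ∈ cDomain α a b c k L) :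
    pd 1 (pd 1 (cDilaton α a b)) p
      = 2 * α / (1 + α ^ 2) * -(a * b / h a b (p 1)) ^ 2 := by
  have hev : ∀ᶠ q in 𝓝 p, q ∈ cDomain α a b c k L := (isOpen_cDomain α a b c k L).mem_nhds hp
  have h1 := (HasPartialAt.of_hasDerivAt (p := p) (hasDerivAt_h_log hp.2.2.1) 1).const_mul
    (2 * α / (1 + α ^ 2))
  refine ((h1.congr ?_).pd_eq).trans (by simp)
  filter_upwards [hev] with q hq
  simpa using (hasPartialAt_cDilaton hq.2.1 hq.2.2.1 1).pd_eq

theorem pd_two_pd_two_cDilaton (hp : p ∈ cDomain α a b c k L) :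
    pd 2 (pd 2 (cDilaton α a b)) p
      = 2 * α / (1 + α ^ 2) * (a * b / h a b (p 2)) ^ 2 := by
  have hev : ∀ᶠ q in 𝓝 p, q ∈ cDomain α a b c k L := (isOpen_cDomain α a b c k L).mem_nhds hp
  have h1 := (HasPartialAt.of_hasDerivAt (p := p) (hasDerivAt_h_log hp.2.1) 2).const_mul
    (-(2 * α / (1 + α ^ 2)))
  refine ((h1.congr ?_).pd_eq).trans (by simp)
  filter_upwards [hev] with q hq
  simpa using (hasPartialAt_cDilaton hq.2.1 hq.2.2.1 2).pd_eq

/-- The source (α/4) e^{-αφ} F² equals 2α times `cStress`. Every term then contains 2α/(1+α²), so no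
division by α is needed and α = 0 is covered. -/
theorem box_cDilaton (ha : a ≠ 0) (hL : L ≠ 0) (hbc : 0 ≤ b * c)
    (hp : p ∈ cDomain α a b c k L) :
    box (cMetric α a b c k L) (cDilaton α a b) p
      = deriv (potential α L) (cDilaton α a b p) - (α / 4)
        * Real.exp (-α * cDilaton α a b p)
        * fieldStrengthSq (cMetric α a b c k L) (cGauge α b c) p := by
  have hj := cMetric_jet ha hp
  have hα := (one_add_sq_pos α).ne'
  have e1 : (α / 4) * Real.exp (-α * cDilaton α a b p)
      * fieldStrengthSq (cMetric α a b c k L) (cGauge α b c) p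
      = 2 * α * cStress α a b c k L p := by
    rw [fieldStrengthSq_cGauge hj, cStress]
    ring
  have e2 : 2 * α * cStress α a b c k L p = -(2 * α / (1 + α ^ 2) *
      ((h a b (p 2) ^ expo α / h a b (p 1) ^ expo α) * (b * c)
        * (a ^ 2 * (p 2 - p 1) ^ 2 / h a b (p 2) ^ expo α) ^ 2)) := by
    rw [cStress_eq hbc hp]
    have : 2 - expo α = 2 / (1 + α ^ 2) := by
      unfold expo
      field_simp
      ring
    rw [this]
    ring
  rw [e1, e2, deriv_potential_cDilaton ha hL hp.2.1 hp.2.2.1, sub_neg_eq_add, ← mul_add,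
    ← (coefficients ha hp).identity_box, hj.box_two_variables (twoVariables_cLogDeriv p)
      (pd_cDilaton_eq_zero (by decide) (by decide)) (pd_cDilaton_eq_zero (by decide) (by decide))
      (hasPartialAt_cDilaton hp.2.1 hp.2.2.1 1).pd_eq
      (hasPartialAt_cDilaton hp.2.1 hp.2.2.1 2).pd_eq (pd_one_pd_one_cDilaton hp)
      (pd_two_pd_two_cDilaton hp)]
  simp only [cLogDeriv, cDiag, Matrix.cons_val_zero, Matrix.cons_val_one, Matrix.cons_val]
  ring

/-! The Einstein and Maxwell equations. -/

/-- The trace-reversed Einstein equation. The signs (1, 1, -1, -1) are those of the mixed Maxwell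
stress of an electric field along y. -/
theorem ricci_cMetric (ha : a ≠ 0) (hL : L ≠ 0) (hbc : 0 ≤ b * c)
    (hp : p ∈ cDomain α a b c k L) (i j : Fin 4) :
    ricci (cMetric α a b c k L) i j p
      = (if i = j then cDiag α a b c k L i p * (![1, 1, -1, -1] i * cStress α a b c k L p
          + (1 / 2) * potential α L (cDilaton α a b p)) else 0)
        + (1 / 2) * (pd i (cDilaton α a b) p * pd j (cDilaton α a b) p) := by
  have hj := cMetric_jet ha hp
  have ht := twoVariables_cLogDeriv (α := α) (a := a) (b := b) (c := c) (k := k) (L := L) p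
  have z : ∀ m : Fin 4, m ≠ 1 → m ≠ 2 → pd m (cDilaton α a b) p = 0 :=
    fun m h1 h2 => congrFun (pd_cDilaton_eq_zero h1 h2) p
  by_cases hij : i = j
  · subst hij
    rw [if_pos rfl]
    match i with
    | 0 => simp [ricci_cMetric_zero_zero ha hL hbc hp, z 0]
    | 1 => simp [ricci_cMetric_one_one ha hL hbc hp]
    | 2 => simp [ricci_cMetric_two_two ha hL hbc hp]
    | 3 => simp [ricci_cMetric_three_three ha hL hbc hp, z 3]
  · rw [if_neg hij, zero_add]
    by_cases h12 : i = 1 ∧ j = 2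
    · rw [h12.1, h12.2, ricci_cMetric_one_two ha hp]
    by_cases h21 : i = 2 ∧ j = 1
    · rw [h21.1, h21.2, hj.ricci_two_one ht, ricci_cMetric_one_two ha hp]
      ring
    · rw [hj.ricci_off_diagonal ht hij h12 h21]
      have : pd i (cDilaton α a b) p * pd j (cDilaton α a b) p = 0 := by
        rw [mul_eq_zero]
        by_cases h1 : i = 1
        · exact Or.inr (z j (fun h => hij (h1.trans h.symm)) fun h => h12 ⟨h1, h⟩)
        by_cases h2 : i = 2
        · exact Or.inr (z j (fun h => h21 ⟨h2, h⟩) fun h => hij (h2.trans h.symm))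
        · exact Or.inl (z i h1 h2)
      rw [this, mul_zero]

theorem stress_cMetric (ha : a ≠ 0) (hp : p ∈ cDomain α a b c k L) (i j : Fin 4) :
    (1 / 2) * Real.exp (-α * cDilaton α a b p) *
          ((∑ m, ∑ l, (cMetric α a b c k L p)⁻¹ m l *
              (fieldStrength (cGauge α b c) i m p * fieldStrength (cGauge α b c) j l p))
            - (1 / 4) * fieldStrengthSq (cMetric α a b c k L) (cGauge α b c) p
              * cMetric α a b c k L p i j)
      = if i = j then cDiag α a b c k L i p * (![1, 1, -1, -1] i * cStress α a b c k L p)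
        else 0 := by
  have hj := cMetric_jet ha hp
  have d0 := hj.ne_zero_self 0
  have d1 := hj.ne_zero_self 1
  have hsum : ∑ m, ∑ l, (cMetric α a b c k L p)⁻¹ m l *
      (fieldStrength (cGauge α b c) i m p * fieldStrength (cGauge α b c) j l p)
      = ∑ m, (cDiag α a b c k L m p)⁻¹ *
        (fieldStrength (cGauge α b c) i m p * fieldStrength (cGauge α b c) j m p) := by
    simp [hj.inv_apply hj.ne_zero_self]
  rw [hsum, fieldStrengthSq_cGauge hj, cMetric_eq, Matrix.diagonal_apply, cStress]
  simp only [fieldStrength_cGauge]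
  generalize 2 * Real.sqrt (b * c / (1 + α ^ 2)) = e
  fin_cases i <;> fin_cases j <;> simp <;> field_simp <;> ring

theorem einstein_cMetric (ha : a ≠ 0) (hL : L ≠ 0) (hbc : 0 ≤ b * c)
    (hp : p ∈ cDomain α a b c k L) (i j : Fin 4) :
    ricci (cMetric α a b c k L) i j p
        - (1 / 2) * scalarCurvature (cMetric α a b c k L) p * cMetric α a b c k L p i j =
      (1 / 2) * Real.exp (-α * cDilaton α a b p) *
          ((∑ m, ∑ l, (cMetric α a b c k L p)⁻¹ m l *
              (fieldStrength (cGauge α b c) i m p * fieldStrength (cGauge α b c) j l p))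
            - (1 / 4) * fieldStrengthSq (cMetric α a b c k L) (cGauge α b c) p
              * cMetric α a b c k L p i j)
        + (1 / 2) * (pd i (cDilaton α a b) p * pd j (cDilaton α a b) p
          - (1 / 2) * gradSq (cMetric α a b c k L) (cDilaton α a b) p
            * cMetric α a b c k L p i j)
        - (1 / 2) * potential α L (cDilaton α a b p) * cMetric α a b c k L p i j := by
  have hj := cMetric_jet ha hp
  -- In the trace the four Maxwell signs cancel, and V/2 is counted four times.
  have hR : scalarCurvature (cMetric α a b c k L) p
      = 2 * potential α L (cDilaton α a b p)
        + (1 / 2) * gradSq (cMetric α a b c k L) (cDilaton α a b) p := by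
    have d0 := hj.ne_zero_self 0
    have d1 := hj.ne_zero_self 1
    have d2 := hj.ne_zero_self 2
    have d3 := hj.ne_zero_self 3
    rw [hj.scalarCurvature_eq, hj.gradSq_eq]
    simp only [ricci_cMetric ha hL hbc hp]
    simp [Fin.sum_univ_four]
    field_simp
    ring
  rw [stress_cMetric ha hp, hR, ricci_cMetric ha hL hbc hp, cMetric_eq, Matrix.diagonal_apply]
  split_ifs <;> ring

/-- By antisymmetry the second Christoffel term drops out, leaving ∂ᵢHⁱʲ + Γⁱᵢₗ Hˡʲ. Along y, F₁/F
cancels in Γⁱᵢ₁ = 4/(x-y) + β ab/h_y, which is the negative of the logarithmic derivative of `U`. -/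
theorem maxwell_cMetric (ha : a ≠ 0) (hp : p ∈ cDomain α a b c k L) (j : Fin 4) :
    divergence₂ (cMetric α a b c k L) (fun i l q => Real.exp (-α * cDilaton α a b q) *
      fieldStrengthUp (cMetric α a b c k L) (cGauge α b c) i l q) j p = 0 := by
  have hj := cMetric_jet ha hp
  have ht := twoVariables_cLogDeriv (α := α) (a := a) (b := b) (c := c) (k := k) (L := L) p
  have hev : ∀ᶠ q in 𝓝 p, q ∈ cDomain α a b c k L := (isOpen_cDomain α a b c k L).mem_nhds hp
  have hA := (Real.rpow_pos_of_pos hp.2.1 (expo α)).ne'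
  have hB := (Real.rpow_pos_of_pos hp.2.2.1 (expo α)).ne'
  have hy := hp.2.2.1.ne'
  have hw := sub_ne_zero.2 hp.1
  -- The density `e^{-αφ} g^{ττ} g^{yy}`.
  let U : Spacetime → ℝ := fun q =>
    -(a ^ 4) * ((q 2 - q 1) ^ 4 / (h a b (q 2) ^ expo α * h a b (q 1) ^ expo α))
  let s : Fin 4 → Fin 4 → ℝ := fun i l => 2 * Real.sqrt (b * c / (1 + α ^ 2)) *
      ((if i = 1 ∧ l = 0 then 1 else 0) - if l = 1 ∧ i = 0 then 1 else 0)
  have hH : ∀ i l, ∀ᶠ q in 𝓝 p, Real.exp (-α * cDilaton α a b q) *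
      fieldStrengthUp (cMetric α a b c k L) (cGauge α b c) i l q = s i l * U q := by
    intro i l
    filter_upwards [hev] with q hq
    have hA := (Real.rpow_pos_of_pos hq.2.1 (expo α)).ne'
    have hB := (Real.rpow_pos_of_pos hq.2.2.1 (expo α)).ne'
    have h01 : cDiag α a b c k L 0 q * cDiag α a b c k L 1 q
      = -(a ^ 2 * (q 2 - q 1) ^ 2 / h a b (q 2) ^ expo α)⁻¹ ^ 2 := cDiag_zero_mul_one hq
    have key : h a b (q 2) ^ expo α / h a b (q 1) ^ expo α *
        (cDiag α a b c k L 0 q * cDiag α a b c k L 1 q)⁻¹ = U q := by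
      rw [h01, inv_neg, inv_pow, inv_inv]
      simp only [U]
      field_simp
    rw [hj.fieldStrengthUp_eq _ _ _ (cDiag_ne_zero ha hq), fieldStrength_cGauge,
      exp_neg_alpha_mul_cDilaton hq.2.1 hq.2.2.1, ← key, mul_inv]
    by_cases h1 : i = 1 ∧ l = 0
    · simp [s, h1.1, h1.2]
      ring
    by_cases h2 : l = 1 ∧ i = 0
    · simp [s, h2.1, h2.2]
      ring
    · simp [s, h1, h2]
  -- The x-derivative is not needed, since the field strength has no component with an index x.
  have hU : ∀ m : Fin 4, m ≠ 2 → HasPartialAt m U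
      ((if m = 1 then -4 / (p 2 - p 1) - expo α * (a * b / h a b (p 1)) else 0) * U p) p := by
    intro m hm
    have x1 : HasPartialAt m (fun q : Spacetime => q 2) (if m = 2 then 1 else 0) p :=
      HasPartialAt.of_hasDerivAt (hasDerivAt_id (p 2)) m
    have y1 : HasPartialAt m (fun q : Spacetime => q 1) (if m = 1 then 1 else 0) p :=
      HasPartialAt.of_hasDerivAt (hasDerivAt_id (p 1)) m
    have w := x1.sub y1
    have w2 := w.mul w
    have A1 := HasPartialAt.of_hasDerivAt (p := p) (hasDerivAt_h_rpow (expo α) hp.2.1) m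
    have B1 := HasPartialAt.of_hasDerivAt (p := p) (hasDerivAt_h_rpow (expo α) hp.2.2.1) m
    have := ((w2.mul w2).div (A1.mul B1) (mul_ne_zero hA hB)).const_mul (-(a ^ 4))
    refine HasDerivAt.congr_deriv (this.congr (Eventually.of_forall fun q => ?_)) ?_
    · simp only [U]
      ring
    · simp only [U, hm, if_false]
      by_cases h1 : m = 1
      · simp only [h1, if_true]
        field_simp
        ring
      · simp [h1]
  have hpd : ∀ i l, pd i (fun q => Real.exp (-α * cDilaton α a b q) *
      fieldStrengthUp (cMetric α a b c k L) (cGauge α b c) i l q) p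
      = s i l * ((if i = 1 then -4 / (p 2 - p 1) - expo α * (a * b / h a b (p 1)) else 0)
        * U p) := by
    intro i l
    by_cases hi : i = 2
    · have hs : s i l = 0 := by simp [s, hi]
      rw [hs, zero_mul]
      refine ((HasPartialAt.const i 0 p).congr ?_).pd_eq
      filter_upwards [hH i l] with q hq
      rw [hq, hs, zero_mul]
    · exact (((hU i hi).const_mul (s i l)).congr (hH i l)).pd_eq
  have hH0 := fun i l => (hH i l).self_of_nhds
  simp only [divergence₂, hpd, hH0, hj.christoffel_eq]
  generalize U p = u
  fin_cases j <;> simp [Fin.sum_univ_four, s, diagChristoffel, ht.first_zero, ht.first_three,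
    div_self (hj.ne_zero_self 1)]
  all_goals simp [cLogDeriv]
  all_goals ring

end EMD

/-! Signature and smoothness of the C-metric. -/

namespace EMD

open Chart

/-- Rescaling the i-th basis vector by |vᵢ|^{-1/2} makes the entries ±1; σ then brings the negative
one to the front. -/
theorem isLorentzian_diagonal {v : Fin 4 → ℝ} (σ : Equiv.Perm (Fin 4)) (h0 : v (σ 0) < 0)
    (h1 : 0 < v (σ 1)) (h2 : 0 < v (σ 2)) (h3 : 0 < v (σ 3)) :
    IsLorentzian (Matrix.diagonal v) := by
  let w : Fin 4 → ℝ := fun i => (√|v i|)⁻¹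
  have hne : ∀ i, v i ≠ 0 := by
    intro i
    obtain ⟨j, rfl⟩ := σ.surjective i
    fin_cases j
    exacts [h0.ne, h1.ne', h2.ne', h3.ne']
  have hw : ∀ i, w i * v i * w i = v i / |v i| := by
    intro i
    have := Real.mul_self_sqrt (abs_nonneg (v i))
    rw [mul_right_comm, ← mul_inv, this, inv_mul_eq_div]
  refine ⟨(Matrix.diagonal w).submatrix id σ, ?_, ?_⟩
  · rw [Matrix.det_permute', Matrix.det_diagonal, isUnit_iff_ne_zero]
    refine mul_ne_zero (by simp) (Finset.prod_ne_zero_iff.2 fun i _ => ?_)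
    exact inv_ne_zero (Real.sqrt_ne_zero'.2 (abs_pos.2 (hne i)))
  · have : ((Matrix.diagonal w).submatrix id σ).transpose * Matrix.diagonal v
        * (Matrix.diagonal w).submatrix id σ
        = (Matrix.diagonal fun i => w i * v i * w i).submatrix σ σ := by
      rw [Matrix.transpose_submatrix, Matrix.diagonal_transpose,
        ← Matrix.submatrix_id_id (Matrix.diagonal v),
        ← Matrix.submatrix_mul _ _ _ _ _ Function.bijective_id,
        ← Matrix.submatrix_mul _ _ _ _ _ Function.bijective_id, Matrix.diagonal_mul_diagonal,
        Matrix.diagonal_mul_diagonal]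
    rw [this, Matrix.submatrix_diagonal_equiv]
    congr 1
    funext i
    simp only [Function.comp, hw]
    fin_cases i
    · simp [abs_of_neg h0, h0.ne]
    · simp [abs_of_pos h1, h1.ne']
    · simp [abs_of_pos h2, h2.ne']
    · simp [abs_of_pos h3, h3.ne']

variable {α a b c k L : ℝ} {p : Spacetime}

theorem cDiag_two_pos (ha : a ≠ 0) (hp : p ∈ cDomain α a b c k L) :
    0 < cDiag α a b c k L 2 p := by
  obtain ⟨h1, h2, h3, h4, h5⟩ := hp
  have h1 := sub_ne_zero.2 h1
  have hB := Real.rpow_pos_of_pos h3 (expo α)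
  simp only [cDiag, Matrix.cons_val]
  positivity

theorem cDiag_three_pos (ha : a ≠ 0) (hp : p ∈ cDomain α a b c k L) :
    0 < cDiag α a b c k L 3 p := by
  obtain ⟨h1, h2, h3, h4, h5⟩ := hp
  have h1 := sub_ne_zero.2 h1
  have hB := Real.rpow_pos_of_pos h3 (expo α)
  simp only [cDiag, Matrix.cons_val]
  positivity

theorem isLorentzian_cMetric (ha : a ≠ 0) (hp : p ∈ cDomain α a b c k L) :
    IsLorentzian (cMetric α a b c k L p) := by
  have h2 := cDiag_two_pos ha hp
  have h3 := cDiag_three_pos ha hp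
  have h01 : cDiag α a b c k L 0 p * cDiag α a b c k L 1 p < 0 := by
    have hA := Real.rpow_pos_of_pos hp.2.1 (expo α)
    have hw := sub_ne_zero.2 hp.1
    rw [cDiag_zero_mul_one hp, neg_lt_zero]
    positivity
  rw [cMetric_eq]
  -- Where F < 0 the timelike coordinate is y rather than τ, hence the transposition.
  rcases mul_neg_iff.1 h01 with ⟨h0, h1⟩ | ⟨h0, h1⟩
  · exact isLorentzian_diagonal (Equiv.swap 0 1) h1 h0 h2 h3
  · exact isLorentzian_diagonal 1 h0 h1 h2 h3

theorem contDiffAt_h_rpow (e : ℝ) (i : Fin 4) (hp : 0 < h a b (p i)) :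
    ContDiffAt ℝ ∞ (fun q : Spacetime => h a b (q i) ^ e) p := by
  have : ContDiffAt ℝ ∞ (fun q : Spacetime => h a b (q i)) p := by
    unfold h
    fun_prop
  exact this.rpow_const_of_ne hp.ne'

theorem contDiffAt_cG (i : Fin 4) (hp : 0 < h a b (p i)) :
    ContDiffAt ℝ ∞ (fun q : Spacetime => cG α a b c k (q i)) p := by
  have : ContDiffAt ℝ ∞ (fun q : Spacetime => cubicP a c k (q i)) p := by
    unfold cubicP
    fun_prop
  exact this.mul (contDiffAt_h_rpow _ i hp)

theorem contDiffAt_cF (i : Fin 4) (hp : 0 < h a b (p i)) :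
    ContDiffAt ℝ ∞ (fun q : Spacetime => cF α a b c k L (q i)) p := by
  simp only [cF_eq]
  exact (contDiffAt_cG i hp).neg.add (contDiffAt_const.mul (contDiffAt_h_rpow _ i hp))

theorem contDiffAt_cDiag (ha : a ≠ 0) (hp : p ∈ cDomain α a b c k L) (i : Fin 4) :
    ContDiffAt ℝ ∞ (cDiag α a b c k L i) p := by
  obtain ⟨h1, h2, h3, h4, h5⟩ := hp
  have h1 := sub_ne_zero.2 h1
  have hΩ : ContDiffAt ℝ ∞ (fun q : Spacetime => 1 / (a ^ 2 * (q 2 - q 1) ^ 2)) p :=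
    contDiffAt_const.div (by fun_prop) (by positivity)
  refine hΩ.mul ?_
  match i with
  | 0 => exact (contDiffAt_h_rpow _ 2 h2).mul (contDiffAt_cF 1 h3).neg
  | 1 => exact (contDiffAt_h_rpow _ 2 h2).mul (contDiffAt_const.div (contDiffAt_cF 1 h3) h4)
  | 2 => exact (contDiffAt_h_rpow _ 1 h3).mul (contDiffAt_const.div (contDiffAt_cG 2 h2) h5.ne')
  | 3 => exact (contDiffAt_h_rpow _ 1 h3).mul (contDiffAt_cG 2 h2)

theorem isSolutionOn_cMetric (ha : a ≠ 0) (hL : L ≠ 0) (hbc : 0 ≤ b * c) :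
    IsSolutionOn α (potential α L) (cDomain α a b c k L) (cMetric α a b c k L) (cGauge α b c)
      (cDilaton α a b) where
  isOpen := isOpen_cDomain α a b c k L
  smooth_metric i j p hp := by
    refine ContDiffAt.contDiffWithinAt ?_
    simp only [cMetric_eq, Matrix.diagonal_apply]
    by_cases hij : i = j
    · simpa only [hij, if_true] using contDiffAt_cDiag ha hp j
    · simpa only [hij, if_false] using contDiffAt_const
  smooth_gauge i p hp := by
    refine ContDiffAt.contDiffWithinAt ?_
    match i with
    | 0 =>
      change ContDiffAt ℝ ∞ (fun p : Spacetime => 2 * √(b * c / (1 + α ^ 2)) * p 1) p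
      fun_prop
    | 1 => exact contDiffAt_const
    | 2 => exact contDiffAt_const
    | 3 => exact contDiffAt_const
  smooth_dilaton p hp := by
    refine ContDiffAt.contDiffWithinAt (contDiffAt_const.mul ?_)
    have hx : ContDiffAt ℝ ∞ (fun q : Spacetime => h a b (q 2)) p := by
      unfold h
      fun_prop
    have hy : ContDiffAt ℝ ∞ (fun q : Spacetime => h a b (q 1)) p := by
      unfold h
      fun_prop
    exact (hy.div hx hp.2.1.ne').log (div_pos hp.2.2.1 hp.2.1).ne'
  lorentzian p hp := isLorentzian_cMetric ha hp
  einstein p hp := einstein_cMetric ha hL hbc hp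
  maxwell p hp := maxwell_cMetric ha hp
  dilaton p hp := box_cDilaton ha hL hbc hp

end EMD

/-! The C-metric in the coordinates `(t, r, x, φ)` and its static limit. -/

namespace EMD

open Chart

variable {α a b c k L : ℝ} {p : Spacetime}

theorem pd_coordChange (ha : a ≠ 0) (hr : p 1 ≠ 0) (i j : Fin 4) :
    pd i (fun q => coordChange a q j) p
      = if i = j then ![a, 1 / (a * p 1 ^ 2), 1, 1] j else 0 := by
  have key : ∀ {f : ℝ → ℝ} {f' : ℝ}, HasDerivAt f f' (p j) →
      (∀ q, coordChange a q j = f (q j)) → f' = ![a, 1 / (a * p 1 ^ 2), 1, 1] j →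
      pd i (fun q => coordChange a q j) p
        = if i = j then ![a, 1 / (a * p 1 ^ 2), 1, 1] j else 0 := by
    intro f f' hf hc hv
    simp only [hc, ← hv]
    exact (HasPartialAt.of_hasDerivAt hf i).pd_eq
  match j with
  | 0 => exact key ((hasDerivAt_id' (p 0)).const_mul a) (fun q => rfl) (by simp)
  | 1 =>
    refine key ((hasDerivAt_const (p 1) (-1 : ℝ)).fun_div ((hasDerivAt_id' (p 1)).const_mul a)
      (mul_ne_zero ha hr)) (fun q => rfl) ?_
    simp
    field_simp
  | 2 => exact key (hasDerivAt_id' (p 2)) (fun q => rfl) (by simp)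
  | 3 => exact key (hasDerivAt_id' (p 3)) (fun q => rfl) (by simp)

theorem h_coordChange (ha : a ≠ 0) (b r : ℝ) : h a b (-1 / (a * r)) = 1 - b / r := by
  unfold h
  field_simp
  ring

/-- At y = -1/(ar) the cubic is 1 - k/(a²r²) + c/(a²r³). Multiplication by a²r² removes every
negative power of a, which makes the limit regular. -/
theorem cF_coordChange (ha : a ≠ 0) {r : ℝ} (hr : r ≠ 0) :
    cF α a b c k L (-1 / (a * r)) = cF' α a b c k L r / (a ^ 2 * r ^ 2) := by
  rw [cF, cF', h_coordChange ha, cubicP]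
  field_simp
  ring

theorem pullbackMetric_coordChange (ha : a ≠ 0) (hr : p 1 ≠ 0)
    (hp : coordChange a p ∈ cDomain α a b c k L) :
    pullbackMetric (coordChange a) (cMetric α a b c k L) p = cMetric' α a b c k L p := by
  obtain ⟨h1, h2, h3, h4, h5⟩ := hp
  have e1 : coordChange a p 1 = -1 / (a * p 1) := rfl
  have e2 : coordChange a p 2 = p 2 := rfl
  rw [e1] at h1 h3 h4
  rw [e2] at h1 h2 h5
  rw [h_coordChange ha] at h3
  rw [cF_coordChange ha hr] at h4
  have h4 : cF' α a b c k L (p 1) ≠ 0 := fun h0 => h4 (by rw [h0, zero_div])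
  have hw : p 2 - -1 / (a * p 1) = (1 + a * p 1 * p 2) / (a * p 1) := by
    field_simp
    ring
  have hw0 : 1 + a * p 1 * p 2 ≠ 0 := by
    intro h0
    rw [h0, zero_div] at hw
    exact h1 (sub_eq_zero.1 hw)
  have h5 := h5.ne'
  ext i j
  have hs : pullbackMetric (coordChange a) (cMetric α a b c k L) p i j
      = ![a, 1 / (a * p 1 ^ 2), 1, 1] i * ![a, 1 / (a * p 1 ^ 2), 1, 1] j
        * cMetric α a b c k L (coordChange a p) i j := by
    simp [pullbackMetric, pd_coordChange ha hr]
  rw [hs, cMetric, cMetric', Matrix.smul_apply, Matrix.smul_apply, Matrix.diagonal_apply,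
    Matrix.diagonal_apply, e1, e2, hw, h_coordChange ha, cF_coordChange ha hr]
  by_cases hij : i = j
  · subst hij
    simp only [if_true, smul_eq_mul]
    fin_cases i <;> simp <;> field_simp
  · simp [hij]

theorem pullbackForm_coordChange (ha : a ≠ 0) (hr : p 1 ≠ 0) (rh : ℝ) :
    pullbackForm (coordChange a) (cGauge α b c) p
      + ![2 * Real.sqrt (b * c / (1 + α ^ 2)) / rh, 0, 0, 0] = gauge' α b c rh p := by
  funext i
  have hs : pullbackForm (coordChange a) (cGauge α b c) p i
      = ![a, 1 / (a * p 1 ^ 2), 1, 1] i * cGauge α b c (coordChange a p) i := by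
    simp [pullbackForm, pd_coordChange ha hr]
  rw [Pi.add_apply, hs]
  fin_cases i <;> simp [cGauge, gauge', coordChange]
  field_simp
  ring

theorem cDilaton_coordChange (ha : a ≠ 0) :
    cDilaton α a b (coordChange a p) = cDilaton' α a b p := by
  have e1 : coordChange a p 1 = -1 / (a * p 1) := rfl
  have e2 : coordChange a p 2 = p 2 := rfl
  rw [cDilaton, cDilaton', e1, e2, h_coordChange ha]

/-! The limit `a → 0`. -/

theorem tendsto_punctured {X : Type*} [TopologicalSpace X] {f : ℝ → X} {v : X}
    (hf : ContinuousAt f 0) (hv : f 0 = v) : Tendsto f (𝓝[≠] 0) (𝓝 v) :=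
  hv ▸ hf.tendsto.mono_left nhdsWithin_le_nhds

theorem h_zero (b ξ : ℝ) : h 0 b ξ = 1 := by
  simp [h]

theorem continuousAt_h (b ξ : ℝ) : ContinuousAt (fun a => h a b ξ) 0 := by
  unfold h
  fun_prop

theorem continuousAt_h_rpow (b ξ e : ℝ) : ContinuousAt (fun a => h a b ξ ^ e) 0 :=
  (continuousAt_h b ξ).rpow_const (Or.inl (by simp [h_zero]))

theorem cG_zero (α b c k x : ℝ) : cG α 0 b c k x = 1 - k * x ^ 2 := by
  simp [cG, cubicP, h_zero]

theorem continuousAt_cG (α b c k x : ℝ) : ContinuousAt (fun a => cG α a b c k x) 0 := by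
  refine ContinuousAt.mul ?_ (continuousAt_h_rpow b x _)
  unfold cubicP
  fun_prop

theorem cF'_zero (α b c k L r : ℝ) : cF' α 0 b c k L r = staticF α b c k L r := by
  simp [cF', staticF]

theorem continuousAt_cF' (α b c k L r : ℝ) : ContinuousAt (fun a => cF' α a b c k L r) 0 := by
  unfold cF'
  fun_prop

/-- In the new coordinates x ≠ y reads 1 + arx ≠ 0 and h_y = 1 - b/r is independent of a. The other
conditions are open and hold at a = 0. -/
theorem eventually_mem_cDomain (hp : p ∈ staticDomain α b c k L) :
    ∀ᶠ a in 𝓝[≠] (0 : ℝ), coordChange a p ∈ cDomain α a b c k L := by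
  obtain ⟨hr, hb, hf, hk⟩ := hp
  have c1 : ContinuousAt (fun a : ℝ => 1 + a * p 1 * p 2) 0 := by fun_prop
  have n1 := nhdsWithin_le_nhds (s := {0}ᶜ) (c1.eventually_ne (by simp : 1 + 0 * p 1 * p 2 ≠ 0))
  have n2 := nhdsWithin_le_nhds (s := {0}ᶜ) ((continuousAt_h b (p 2)).eventually
    (lt_mem_nhds (by simp [h_zero] : (0 : ℝ) < h 0 b (p 2))))
  have n3 := nhdsWithin_le_nhds (s := {0}ᶜ) ((continuousAt_cF' α b c k L (p 1)).eventually_ne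
    (by rwa [cF'_zero]))
  have n4 := nhdsWithin_le_nhds (s := {0}ᶜ) ((continuousAt_cG α b c k (p 2)).eventually
    (lt_mem_nhds (by rwa [cG_zero] : (0 : ℝ) < cG α 0 b c k (p 2))))
  filter_upwards [n1, n2, n3, n4, self_mem_nhdsWithin] with a m1 m2 m3 m4 ha
  have ha : a ≠ 0 := ha
  have e1 : coordChange a p 1 = -1 / (a * p 1) := rfl
  have e2 : coordChange a p 2 = p 2 := rfl
  refine ⟨?_, ?_, ?_, ?_, ?_⟩
  · rw [e1, e2]
    intro h0
    apply m1
    rw [h0]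
    field_simp
    ring
  · rwa [e2]
  · rwa [e1, h_coordChange ha]
  · rw [e1, cF_coordChange ha hr]
    positivity
  · rwa [e2]

theorem tendsto_cMetric' (hp : p ∈ staticDomain α b c k L) :
    Tendsto (fun a => cMetric' α a b c k L p) (𝓝[≠] 0) (𝓝 (staticMetric α b c k L p)) := by
  obtain ⟨hr, hb, hf, hk⟩ := hp
  have hΩ : ContinuousAt (fun a : ℝ => 1 / (1 + a * p 1 * p 2) ^ 2) 0 :=
    continuousAt_const.div (by fun_prop) (by simp)
  have hA := continuousAt_h_rpow b (p 2) (2 * α ^ 2 / (1 + α ^ 2))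
  have hF := continuousAt_cF' α b c k L (p 1)
  have hG := continuousAt_cG α b c k (p 2)
  refine tendsto_punctured (hΩ.smul (Continuous.continuousAt (continuous_id.matrix_diagonal) |>.comp
    (continuousAt_pi.2 fun i => ?_))) ?_
  · match i with
    | 0 => exact hA.mul hF.neg
    | 1 => exact hA.mul (continuousAt_const.div hF (by rwa [cF'_zero]))
    | 2 => exact continuousAt_const.mul (continuousAt_const.div hG (by rw [cG_zero]; exact hk.ne'))
    | 3 => exact continuousAt_const.mul hG
  · rw [cMetric', staticMetric]
    simp [h_zero, cG_zero, cF'_zero, staticU, sigmaMetric]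

theorem tendsto_gauge' {rh : ℝ → ℝ} {rh₀ : ℝ} (h0 : rh₀ ≠ 0)
    (hrh : Tendsto rh (𝓝[≠] 0) (𝓝 rh₀)) :
    Tendsto (fun a => gauge' α b c (rh a) p) (𝓝[≠] 0) (𝓝 (gauge' α b c rh₀ p)) := by
  refine tendsto_pi_nhds.2 fun i => ?_
  match i with
  | 0 => exact ((tendsto_const_nhds.div hrh h0).sub_const _).const_mul _
  | 1 => exact tendsto_const_nhds
  | 2 => exact tendsto_const_nhds
  | 3 => exact tendsto_const_nhds

theorem tendsto_cDilaton' (hb : 0 < 1 - b / p 1) :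
    Tendsto (fun a => cDilaton' α a b p) (𝓝[≠] 0) (𝓝 (staticDilaton α b p)) := by
  refine tendsto_punctured (continuousAt_const.mul ((continuousAt_const.div
    (continuousAt_h b (p 2)) (by simp [h_zero])).log ?_)) ?_
  · simpa [h_zero] using hb.ne'
  · simp [cDilaton', staticDilaton, h_zero]

theorem exp_alpha_mul_staticDilaton (hb : 0 < 1 - b / p 1) :
    Real.exp (α * staticDilaton α b p) = (1 - b / p 1) ^ (2 * α ^ 2 / (1 + α ^ 2)) := by
  rw [Real.rpow_def_of_pos hb, staticDilaton]
  congr 1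
  ring

/-! The transverse metric. -/

theorem sigmaMetric_jet {k : ℝ} {q : Fin 2 → ℝ} (hq : 0 < 1 - k * q 0 ^ 2) :
    DiagonalJet (sigmaMetric k)
      (fun i q => ![1 / (1 - k * q 0 ^ 2), 1 - k * q 0 ^ 2] i)
      (fun j i q => ![![2 * k * q 0 / (1 - k * q 0 ^ 2), -(2 * k * q 0 / (1 - k * q 0 ^ 2))], 0] j i)
      (fun m j i => ![![![2 * k * (1 + k * q 0 ^ 2) / (1 - k * q 0 ^ 2) ^ 2,
        -(2 * k * (1 + k * q 0 ^ 2) / (1 - k * q 0 ^ 2) ^ 2)], 0], 0] m j i) q := by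
  have hc : ContinuousAt (fun r : Fin 2 → ℝ => 1 - k * r 0 ^ 2) q :=
    (by fun_prop : Continuous fun r : Fin 2 → ℝ => 1 - k * r 0 ^ 2).continuousAt
  have hev := hc.eventually (lt_mem_nhds hq)
  have hd : ∀ x : ℝ, HasDerivAt (fun x => 1 - k * x ^ 2) (-(2 * k * x)) x := by
    intro x
    refine HasDerivAt.congr_deriv (((hasDerivAt_pow 2 x).const_mul k).const_sub 1) ?_
    push_cast
    ring
  refine ⟨fun _ => rfl, hev.mono fun r hr i => ?_, hev.mono fun r hr j i => ?_, fun m j i => ?_⟩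
  · fin_cases i <;> simp [hr.ne']
  · have h0 := hr.ne'
    match i with
    | 0 =>
      refine HasDerivAt.congr_deriv (HasPartialAt.of_hasDerivAt (p := r)
        ((hasDerivAt_const (r 0) (1 : ℝ)).fun_div (hd (r 0)) h0) j) ?_
      fin_cases j <;> simp
      field_simp
    | 1 =>
      refine HasDerivAt.congr_deriv (HasPartialAt.of_hasDerivAt (p := r) (hd (r 0)) j) ?_
      fin_cases j <;> simp
      field_simp
  · have h0 := hq.ne'
    have hP := ((hasDerivAt_id' (q 0)).const_mul (2 * k)).fun_div (hd (q 0)) h0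
    match j, i with
    | 0, 0 =>
      refine HasDerivAt.congr_deriv (HasPartialAt.of_hasDerivAt (p := q) hP m) ?_
      fin_cases m <;> simp
      field_simp
      ring
    | 0, 1 =>
      refine HasDerivAt.congr_deriv (HasPartialAt.of_hasDerivAt (p := q) hP.fun_neg m) ?_
      fin_cases m <;> simp
      field_simp
      ring
    | 1, i =>
      refine HasDerivAt.congr_deriv (HasPartialAt.const m 0 q) ?_
      fin_cases m <;> simp

/-- In dimension two the Ricci tensor is the Gaussian curvature times the metric, so this expresses
curvature k. -/
theorem ricci_sigmaMetric {k : ℝ} {q : Fin 2 → ℝ} (hq : 0 < 1 - k * q 0 ^ 2) (i j : Fin 2) :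
    ricci (sigmaMetric k) i j q = k * sigmaMetric k q i j := by
  have h0 := hq.ne'
  rw [(sigmaMetric_jet hq).ricci_eq, sigmaMetric]
  fin_cases i <;> fin_cases j <;>
    simp [diagChristoffel, diagChristoffelDeriv] <;> field_simp <;> ring

end EMD

/-! Level sets of a coordinate function in a diagonal metric. -/

namespace Chart

namespace DiagonalJet

variable {n : ℕ} {g : (Fin n → ℝ) → Matrix (Fin n) (Fin n) ℝ} {d : Fin n → (Fin n → ℝ) → ℝ}
  {P : Fin n → Fin n → (Fin n → ℝ) → ℝ} {Q : Fin n → Fin n → Fin n → ℝ} {p : Fin n → ℝ}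

theorem pd_const_mul_coordinate (a : ℝ) (m i : Fin n) (q : Fin n → ℝ) :
    pd i (fun q => a * q m) q = if i = m then a else 0 := by
  refine (HasPartialAt.of_hasDerivAt (p := q)
    ((hasDerivAt_id' (q m)).const_mul a) i).pd_eq.trans ?_
  rw [mul_one]

/-- An equality of functions, because the extrinsic curvature differentiates the conormal. The
component m never has to be differentiated: the projector annihilates it. -/
theorem unitConormal_of_ne (a : ℝ) {m i : Fin n} (hi : i ≠ m) :
    unitConormal g (fun q => a * q m) i = fun _ => 0 := by
  funext q
  rw [unitConormal, pd_const_mul_coordinate, if_neg hi, zero_div]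

theorem unitConormal_self (hj : DiagonalJet g d P Q p) (a : ℝ) (m : Fin n) :
    unitConormal g (fun q => a * q m) m p = a / √(a ^ 2 / d m p) := by
  rw [unitConormal, pd_const_mul_coordinate, if_pos rfl, hj.gradSq_eq]
  simp only [pd_const_mul_coordinate]
  congr 2
  simp
  ring

/-- The component is sign(a) √d_m; the sign disappears in the square, so a affects only the
orientation of the normal. -/
theorem unitConormal_self_sq (hj : DiagonalJet g d P Q p) {a : ℝ} (ha : a ≠ 0) {m : Fin n}
    (hm : 0 < d m p) :
    unitConormal g (fun q => a * q m) m p * unitConormal g (fun q => a * q m) m p = d m p := by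
  have h0 : 0 ≤ a ^ 2 / d m p := by positivity
  have hm' := hm.ne'
  rw [hj.unitConormal_self, div_mul_div_comm, Real.mul_self_sqrt h0]
  field_simp

theorem inducedMetric_coordinate (hj : DiagonalJet g d P Q p) {a : ℝ} (ha : a ≠ 0) {m : Fin n}
    (hm : 0 < d m p) (i j : Fin n) :
    inducedMetric g (fun q => a * q m) i j p = if i = j ∧ i ≠ m then d i p else 0 := by
  rw [inducedMetric, hj.diag, Matrix.diagonal_apply]
  by_cases hi : i = m
  · subst hi
    by_cases h : i = j
    · subst h
      simp [hj.unitConormal_self_sq ha hm]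
    · simp [unitConormal_of_ne a (Ne.symm h), h]
  · simp [unitConormal_of_ne a hi, hi]

theorem tangentialProj_coordinate (hj : DiagonalJet g d P Q p) {a : ℝ} (ha : a ≠ 0) {m : Fin n}
    (hm : 0 < d m p) (i j : Fin n) :
    tangentialProj g (fun q => a * q m) i j p = if i = j ∧ j ≠ m then 1 else 0 := by
  have hsum : ∑ l, (g p)⁻¹ i l * unitConormal g (fun q => a * q m) l p
      = (d i p)⁻¹ * unitConormal g (fun q => a * q m) i p := by
    simp [hj.inv_apply hj.ne_zero_self]
  rw [tangentialProj, hsum]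
  by_cases hjm : j = m
  · subst hjm
    by_cases hi : i = j
    · subst hi
      rw [mul_assoc, hj.unitConormal_self_sq ha hm, inv_mul_cancel₀ hm.ne']
      simp
    · simp [unitConormal_of_ne a hi, hi]
  · simp [unitConormal_of_ne a hjm, hjm]

/-- For tangential indices K_ij = -Γᵐᵢⱼ n_m, which is nonzero only for i = j, where Γᵐᵢᵢ = -½ `P m
i` dᵢ/d_m. -/
theorem extrinsicCurvature_coordinate (hj : DiagonalJet g d P Q p) {a : ℝ} (ha : a ≠ 0)
    {m : Fin n} (hm : 0 < d m p) (i j : Fin n) :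
    extrinsicCurvature g (fun q => a * q m) i j p
      = if i = j ∧ i ≠ m then (1 / 2) * P m i p * (√(a ^ 2 / d m p) / a) * d i p else 0 := by
  have hsum : ∀ i j, ∑ l, christoffel g l i j p * unitConormal g (fun q => a * q m) l p
      = diagChristoffel d P m i j p * unitConormal g (fun q => a * q m) m p := by
    intro i j
    rw [Finset.sum_eq_single m, hj.christoffel_eq]
    · intro l _ hl
      rw [unitConormal_of_ne a hl, mul_zero]
    · simp
  have h1 : extrinsicCurvature g (fun q => a * q m) i j p = if i ≠ m ∧ j ≠ m then
      (pd i (unitConormal g (fun q => a * q m) j) p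
        - ∑ l, christoffel g l i j p * unitConormal g (fun q => a * q m) l p) else 0 := by
    simp only [extrinsicCurvature, hj.tangentialProj_coordinate ha hm]
    by_cases hi : i = m <;> by_cases hjm : j = m <;> simp [hi, hjm]
  rw [h1, hsum]
  by_cases hi : i = m
  · simp [hi]
  by_cases hjm : j = m
  · subst hjm
    simp [hi]
  rw [if_pos ⟨hi, hjm⟩, unitConormal_of_ne a hjm, (HasPartialAt.const i 0 p).pd_eq,
    hj.unitConormal_self, diagChristoffel]
  by_cases hij : i = j
  · subst hij
    have hs : √(a ^ 2 / d m p) ^ 2 = a ^ 2 / d m p := Real.sq_sqrt (by positivity)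
    have hs0 : √(a ^ 2 / d m p) ≠ 0 := by positivity
    have hm' := hm.ne'
    have key : a / √(a ^ 2 / d m p) / d m p = √(a ^ 2 / d m p) / a := by
      rw [div_div, div_eq_div_iff (mul_ne_zero hs0 hm') ha]
      have : √(a ^ 2 / d m p) * (√(a ^ 2 / d m p) * d m p) = a ^ 2 := by
        rw [← mul_assoc, ← pow_two, hs]
        field_simp
      rw [this, pow_two]
    simp only [Ne.symm hi, hi, if_false, if_true, ne_eq, not_false_eq_true, and_true, ← key]
    ring
  · simp [hij, Ne.symm hi, Ne.symm hjm]

end DiagonalJet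

end Chart

/-! The umbilic hypersurface. -/

namespace EMD

open Chart

variable {α a b c k L : ℝ} {p : Spacetime}

theorem cubicP_pos (hp : p ∈ cDomain α a b c k L) : 0 < cubicP a c k (p 2) :=
  (mul_pos_iff_of_pos_right (Real.rpow_pos_of_pos hp.2.1 _)).1 hp.2.2.2.2

/-- The exponent of h_x in the denominator is (1+β)/2 and that of h_y is β/2. The condition x > y
fixes the sign of the root. -/
theorem sqrt_sq_div_cDiag_two (ha : a ≠ 0) (hp : p ∈ cDomain α a b c k L)
    (hw : 0 < p 2 - p 1) :
    √(a ^ 2 / cDiag α a b c k L 2 p) = a ^ 2 * (p 2 - p 1) * √(cubicP a c k (p 2))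
      * h a b (p 2) / (h a b (p 2) ^ ((1 + 3 * α ^ 2) / (2 * (1 + α ^ 2)))
        * h a b (p 1) ^ (α ^ 2 / (1 + α ^ 2))) := by
  have hP := cubicP_pos hp
  obtain ⟨h1, h2, h3, h4, h5⟩ := hp
  have hα := (one_add_sq_pos α).ne'
  have hA := (Real.rpow_pos_of_pos h2 (expo α)).ne'
  have hB := (Real.rpow_pos_of_pos h3 (expo α)).ne'
  have eX : (h a b (p 2) ^ ((1 + 3 * α ^ 2) / (2 * (1 + α ^ 2)))) ^ 2
      = h a b (p 2) * h a b (p 2) ^ expo α := by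
    rw [← Real.rpow_natCast, ← Real.rpow_mul h2.le, mul_comm (h a b (p 2)),
      ← Real.rpow_add_one h2.ne']
    congr 1
    unfold expo
    push_cast
    field_simp
    ring
  have eY : (h a b (p 1) ^ (α ^ 2 / (1 + α ^ 2))) ^ 2 = h a b (p 1) ^ expo α := by
    rw [← Real.rpow_natCast, ← Real.rpow_mul h3.le]
    congr 1
    unfold expo
    push_cast
    ring
  have p1 := Real.rpow_pos_of_pos h2 ((1 + 3 * α ^ 2) / (2 * (1 + α ^ 2)))
  have p2 := Real.rpow_pos_of_pos h3 (α ^ 2 / (1 + α ^ 2))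
  rw [Real.sqrt_eq_iff_mul_self_eq_of_pos (by positivity), ← pow_two, div_pow, mul_pow, mul_pow,
    mul_pow, mul_pow, eX, eY, Real.sq_sqrt hP.le]
  simp only [cDiag, Matrix.cons_val, cG_eq, h_rpow_one_sub_expo α h2]
  have hP' := hP.ne'
  have hw' := hw.ne'
  have h2' := h2.ne'
  field_simp

/-- The ττ and yy entries already share this value, so only φφ has to be matched. It requires G'/G =
β ab/h_x, and clearing denominators there yields minus `braneCubic`, up to the factor 1 + α². -/
theorem cLogDeriv_two_eq_of_braneCubic (hp : p ∈ cDomain α a b c k L)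
    (hx : braneCubic α a b c k (p 2) = 0) {i : Fin 4} (hi : i ≠ 2) :
    cLogDeriv α a b c k L 2 i p
      = -(2 / (p 2 - p 1)) + expo α * (a * b / h a b (p 2)) := by
  have hα := (one_add_sq_pos α).ne'
  have h2 := hp.2.1.ne'
  have hG : cG1 α a b c k (p 2) / cG α a b c k (p 2) = expo α * (a * b / h a b (p 2)) := by
    rw [div_eq_iff hp.2.2.2.2.ne', cG1, cG_eq, ← mul_assoc (expo α * _)]
    congr 1
    have : (1 + α ^ 2) * ((-2 * k * p 2 - 3 * a * c * p 2 ^ 2) * h a b (p 2)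
        + cubicP a c k (p 2) * ((1 - 2 * expo α) * (a * b))) = -braneCubic α a b c k (p 2) := by
      unfold expo cubicP h braneCubic
      field_simp
      ring
    rw [hx, neg_zero, mul_eq_zero, or_iff_right hα] at this
    field_simp
    linear_combination this
  match i with
  | 0 => simp [cLogDeriv]
  | 1 => simp [cLogDeriv]
  | 2 => exact absurd rfl hi
  | 3 => simp [cLogDeriv, hG]

theorem umbilic_cMetric (ha : a ≠ 0) (hp : p ∈ cDomain α a b c k L)
    (hx : braneCubic α a b c k (p 2) = 0) (hw : 0 < p 2 - p 1) (i j : Fin 4) :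
    extrinsicCurvature (cMetric α a b c k L) (fun q => a * q 2) i j p =
      -braneLambda α a b c k (p 2) (p 1) *
        inducedMetric (cMetric α a b c k L) (fun q => a * q 2) i j p := by
  have hj := cMetric_jet ha hp
  have hd := cDiag_two_pos ha hp
  rw [hj.extrinsicCurvature_coordinate ha hd, hj.inducedMetric_coordinate ha hd]
  by_cases hij : i = j ∧ i ≠ 2
  · rw [if_pos hij, if_pos hij]
    congr 1
    rw [cLogDeriv_two_eq_of_braneCubic hp hx hij.2, sqrt_sq_div_cDiag_two ha hp hw]
    have hα := (one_add_sq_pos α).ne'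
    have h2 := hp.2.1.ne'
    have p1 := (Real.rpow_pos_of_pos hp.2.1 ((1 + 3 * α ^ 2) / (2 * (1 + α ^ 2)))).ne'
    have p2 := (Real.rpow_pos_of_pos hp.2.2.1 (α ^ 2 / (1 + α ^ 2))).ne'
    have hw' := hw.ne'
    have e : braneLambda α a b c k (p 2) (p 1) = a * √(cubicP a c k (p 2))
        * (h a b (p 2) + α ^ 2 * h a b (p 1)) / ((1 + α ^ 2)
          * h a b (p 2) ^ ((1 + 3 * α ^ 2) / (2 * (1 + α ^ 2)))
          * h a b (p 1) ^ (α ^ 2 / (1 + α ^ 2))) := rfl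
    have hXY : h a b (p 1) = h a b (p 2) - a * b * (p 2 - p 1) := by
      unfold h
      ring
    -- The common logarithmic derivative becomes the linear factor of λ on writing ab(x-y) = h_x -
    -- h_y.
    have hlin : (1 / 2) * (-(2 / (p 2 - p 1)) + expo α * (a * b / h a b (p 2)))
        * (p 2 - p 1) * h a b (p 2) * (1 + α ^ 2)
        = -(h a b (p 2) + α ^ 2 * h a b (p 1)) := by
      rw [hXY, expo]
      field_simp
      ring
    rw [e, eq_comm, ← neg_div, ← mul_neg, ← hlin]
    generalize h a b (p 2) ^ ((1 + 3 * α ^ 2) / (2 * (1 + α ^ 2))) = S at *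
    generalize h a b (p 1) ^ (α ^ 2 / (1 + α ^ 2)) = T at *
    generalize -(2 / (p 2 - p 1)) + expo α * (a * b / h a b (p 2)) = R
    field_simp
  · rw [if_neg hij, if_neg hij, mul_zero]

end EMD

end

/-! ### Assembly of the main theorem. -/

theorem mainTheorem5 (α b c k L : ℝ) (hk : k = 0 ∨ k = 1 ∨ k = -1) (hbc : 0 ≤ b * c)
    (hL : 0 < L) :
    -- The C-metric solves the system.
    (∀ a : ℝ, a ≠ 0 →
      EMD.IsSolutionOn α (EMD.potential α L) (EMD.cDomain α a b c k L)
        (EMD.cMetric α a b c k L) (EMD.cGauge α b c) (EMD.cDilaton α a b) ∧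
      ∀ p ∈ EMD.cDomain α a b c k L,
        Real.exp (α * EMD.cDilaton α a b p) =
          (EMD.h a b (p 1) / EMD.h a b (p 2)) ^ (2 * α ^ 2 / (1 + α ^ 2))) ∧
    -- Its form in the coordinates (t, r, x, φ).
    (∀ a : ℝ, a ≠ 0 → ∀ p : EMD.Spacetime, p 1 ≠ 0 →
      EMD.coordChange a p ∈ EMD.cDomain α a b c k L →
      Chart.pullbackMetric (EMD.coordChange a) (EMD.cMetric α a b c k L) p =
        EMD.cMetric' α a b c k L p ∧
      (∀ rh : ℝ, rh ≠ 0 →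
        Chart.pullbackForm (EMD.coordChange a) (EMD.cGauge α b c) p
            + ![2 * Real.sqrt (b * c / (1 + α ^ 2)) / rh, 0, 0, 0] =
          EMD.gauge' α b c rh p) ∧
      EMD.cDilaton α a b (EMD.coordChange a p) = EMD.cDilaton' α a b p) ∧
    -- The limit a → 0 is the static solution.
    (∀ p ∈ EMD.staticDomain α b c k L,
      (∀ᶠ a in 𝓝[≠] (0 : ℝ), EMD.coordChange a p ∈ EMD.cDomain α a b c k L) ∧
      Tendsto (fun a => EMD.cMetric' α a b c k L p) (𝓝[≠] 0)
        (𝓝 (EMD.staticMetric α b c k L p)) ∧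
      (∀ (rh : ℝ → ℝ) (rh₀ : ℝ), rh₀ ≠ 0 → Tendsto rh (𝓝[≠] 0) (𝓝 rh₀) →
        Tendsto (fun a => EMD.gauge' α b c (rh a) p) (𝓝[≠] 0)
          (𝓝 (EMD.gauge' α b c rh₀ p))) ∧
      Tendsto (fun a => EMD.cDilaton' α a b p) (𝓝[≠] 0) (𝓝 (EMD.staticDilaton α b p)) ∧
      Real.exp (α * EMD.staticDilaton α b p) =
        (1 - b / p 1) ^ (2 * α ^ 2 / (1 + α ^ 2))) ∧
    -- The transverse metric of the static solution has constant Gaussian curvature k.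
    (∀ q : Fin 2 → ℝ, 0 < 1 - k * q 0 ^ 2 → ∀ i j,
      Chart.ricci (EMD.sigmaMetric k) i j q = k * EMD.sigmaMetric k q i j) ∧
    -- The hypersurface x = x₀ is totally umbilic; its unit normal points in the direction of
    -- increasing a x, that is, of increasing x if a > 0.
    (∀ a : ℝ, a ≠ 0 → ∀ x₀ : ℝ, EMD.braneCubic α a b c k x₀ = 0 →
      ∀ p ∈ EMD.cDomain α a b c k L, p 2 = x₀ → 0 < x₀ - p 1 →
        ∀ μ ν, Chart.extrinsicCurvature (EMD.cMetric α a b c k L) (fun q => a * q 2) μ ν p =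
          -EMD.braneLambda α a b c k x₀ (p 1) *
            Chart.inducedMetric (EMD.cMetric α a b c k L) (fun q => a * q 2) μ ν p) := by
  refine ⟨fun a ha => ⟨EMD.isSolutionOn_cMetric ha hL.ne' hbc, fun p hp =>
      EMD.exp_alpha_mul_cDilaton hp.2.1 hp.2.2.1⟩,
    fun a ha p hr hp => ⟨EMD.pullbackMetric_coordChange ha hr hp,
      fun rh _ => EMD.pullbackForm_coordChange ha hr rh, EMD.cDilaton_coordChange ha⟩,
    fun p hp => ⟨EMD.eventually_mem_cDomain hp, EMD.tendsto_cMetric' hp,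
      fun rh rh₀ h0 hrh => EMD.tendsto_gauge' h0 hrh, EMD.tendsto_cDilaton' hp.2.1,
      EMD.exp_alpha_mul_staticDilaton hp.2.1⟩,
    fun q hq i j => EMD.ricci_sigmaMetric hq i j, ?_⟩
  rintro a ha x₀ hx₀ p hp rfl hw μ ν
  exact EMD.umbilic_cMetric ha hp hx₀ hw μ ν
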